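/- Let $V,H$ be real Hilbert spaces forming a Gelfand triple $V\hookrightarrow H\cong H^*\hookrightarrow V^*$ with dense and compact embedding, and let $a:V\times V\to\mathbb R$ be a continuous bilinear form for which there are $\alpha_0>0$, $\omega_0\ge 0$ with $a(v,v)+\omega_0\|v\|_H^2\ge\alpha_0\|v\|_V^2$ for all $v\in V$; let $A:V\to V^*$, $\langle Ay,v\rangle=a(y,v)$. Let $(\omega,\varrho)$ be a measure space, $B:L^2(\omega)\to V^*$ linear and continuous with adjoint $B^*:V\to L^2(\omega)$, $u_a,u_b\in L^\infty(\omega)$ with $u_a<u_b$ a.e., $y_0,y_d\in H$ and $\delta_0>0$. Put $I=(0,1)$, $U=L^2(I\times\omega)=L^2(I;L^2(\omega))$ and $U_{ad}=\{u\in U: u_a\le u(t)\le u_b \text{ a.e. in }\omega\text{ for a.e. } t\in I\}$. For $\nu>0$ and $u\in U$ let $y=S(\nu,u)\in W(0,1)=H^1(I;V^*)\cap L^2(I;V)$ be the solution of $$\partial_t y+\nu Ay=\nu Bu,\qquad y(0)=y_0,$$ let $f(\nu,u)=\|y(1)-y_d\|_H-\delta_0$, and let $$\bar u(\nu)=\operatorname*{argmin}_{u\in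 U_{ad}}\|S(\nu,u)(1)-y_d\|_H$$ be the set of distance-optimal controls. If $y(1)\ne y_d$, the adjoint state $p=p(\nu,u)\in W(0,1)$ is defined by $$-\partial_t p+\nu A^*p=0,\qquad p(1)=\frac{y(1)-y_d}{\|y(1)-y_d\|_H}.$$ Let $0<\nu_{\min}<\nu_{\max}$ and suppose that, with a constant $c_s$, $$\|B^*(p(\nu_1,u)-p(\nu_2,u))\|_{L^\infty(I\times\omega)}\le c_s|\nu_1-\nu_2|$$ for all $\nu_1,\nu_2\in[\nu_{\min},\nu_{\max}]$ and all $u\in U_{ad}$ for which both adjoint states are defined. Let $\bar\nu\in(\nu_{\min},\nu_{\max})$ be such that $\bar u(\bar\nu)=\{\bar u\}$ is a singleton, and suppose that $f(\bar\nu,\cdot):U\to\mathbb R$ is Fréchet differentiable at $\bar u$ and that for some $c_0>0$ $$\partial_u f(\bar\nu,\bar u)(u'-\bar u)\ \ge\ \bar\nu\, c_0\,\|u'-\bar u\|_{L^1(I\times\omega)}^2\qquad\text{for all }u'\in U_{ad}.$$ Then there are $\delta>0$ and a constant $c>0$, independent of $\nu$ and $u$, such that $$\|u-\bar u\|_{L^1(I\times\omega)}\le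 c\,|\nu-\bar\nu|\qquad\text{for all }\nu>0\text{ with }|\nu-\bar\nu|\le\delta\text{ and all }u\in\bar u(\nu).$$ -/

import Mathlib

open MeasureTheory Set
open scoped ENNReal RealInnerProductSpace

noncomputable section

namespace ParabolicControl

/-- The reference time interval `I = (0,1)` with Lebesgue measure. -/
abbrev timeMeasure : Measure ℝ := volume.restrict (Ioo (0 : ℝ) 1)

/-- The control space `L²(I × ω)`, in the form `L²(I; L²(ω))`. -/
abbrev Control {Ω : Type*} [MeasurableSpace Ω] (ϱ : Measure Ω) : Type _ :=
  Lp (Lp ℝ 2 ϱ) 2 timeMeasure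

/-- The `L¹(I × ω)` norm, with value `∞` for functions that are not integrable:
`∫_I ‖g(t)‖_{L¹(ω)} dt`. -/
def normL1 {Ω : Type*} [MeasurableSpace Ω] {ϱ : Measure Ω} (g : ℝ → Lp ℝ 2 ϱ) : ℝ≥0∞ :=
  ∫⁻ t, eLpNorm (g t) 1 ϱ ∂timeMeasure

/-- The `L^∞(I × ω)` norm, with value `∞` for functions that are not essentially bounded:
`ess sup_{t ∈ I} ‖g(t)‖_{L^∞(ω)}`. -/
def normLInf {Ω : Type*} [MeasurableSpace Ω] {ϱ : Measure Ω} (g : ℝ → Lp ℝ 2 ϱ) : ℝ≥0∞ :=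
  essSup (fun t => eLpNorm (g t) ∞ ϱ) timeMeasure

/-- The data of the control problem: a Gelfand triple `V ↪ H ≅ H* ↪ V*` with compact embedding
`ι : V → H`, a continuous bilinear form `a` on `V` with the Gårding inequality, a control operator
`B : L²(ω) → V*`, control bounds `ua < ub` in `L^∞(ω)`, the initial state, the desired state and
the radius of the target ball. -/
structure System (V H Ω : Type*)
    [NormedAddCommGroup V] [InnerProductSpace ℝ V]
    [NormedAddCommGroup H] [InnerProductSpace ℝ H]
    [MeasurableSpace Ω] (ϱ : Measure Ω) where
  /-- the embedding of `V` into `H` -/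
  ι : V →L[ℝ] H
  ι_injective : Function.Injective ι
  ι_dense : DenseRange ι
  ι_compact : IsCompactOperator ι
  /-- the bilinear form; as a map `V → V*` it is the operator `A` -/
  a : V →L[ℝ] V →L[ℝ] ℝ
  garding : ∃ α₀ > (0 : ℝ), ∃ ω₀ ≥ (0 : ℝ), ∀ v : V, α₀ * ‖v‖ ^ 2 ≤ a v v + ω₀ * ‖ι v‖ ^ 2
  /-- the control operator -/
  B : Lp ℝ 2 ϱ →L[ℝ] (V →L[ℝ] ℝ)
  /-- the lower control bound -/
  ua : Lp ℝ ∞ ϱ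
  /-- the upper control bound -/
  ub : Lp ℝ ∞ ϱ
  ua_lt_ub : ∀ᵐ x ∂ϱ, ua x < ub x
  /-- the initial state -/
  y0 : H
  /-- the desired state -/
  yd : H
  /-- the radius of the target ball -/
  δ₀ : ℝ
  δ₀_pos : 0 < δ₀

namespace System

variable {V H Ω : Type*}
  [NormedAddCommGroup V] [InnerProductSpace ℝ V]
  [NormedAddCommGroup H] [InnerProductSpace ℝ H]
  [MeasurableSpace Ω] {ϱ : Measure Ω}

/-- The embedding `H ≅ H* ↪ V*`, `h ↦ (v ↦ (h, v)_H)`. -/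
def toVDual (P : System V H Ω ϱ) : H →L[ℝ] (V →L[ℝ] ℝ) :=
  (ContinuousLinearMap.precomp ℝ P.ι).comp (innerSL ℝ)

theorem toVDual_apply (P : System V H Ω ϱ) (h : H) (v : V) : P.toVDual h v = ⟪h, P.ι v⟫ := rfl

/-- The adjoint control operator `B* : V → L²(ω)` (with `V** = V` and `L²(ω)* = L²(ω)`). -/
def Badj (P : System V H Ω ϱ) (v : V) : Lp ℝ 2 ϱ :=
  (InnerProductSpace.toDual ℝ (Lp ℝ 2 ϱ)).symm (P.B.flip v)

theorem inner_Badj (P : System V H Ω ϱ) (v : V) (q : Lp ℝ 2 ϱ) : ⟪P.Badj v, q⟫ = P.B q v := by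
  simp [Badj]

/-- `y ∈ W(0,1) = H¹(I; V*) ∩ L²(I; V)` with time derivative `∂ₜ y = g ∈ L²(I; V*)`, and `w` is
its representative in `C([0,1]; H)`, so that `y(t) = w t` in the sense of traces.  The derivative
relation is that of absolutely continuous functions: `y(t) = y(0) + ∫₀ᵗ g(s) ds` in `V*`. -/
structure InW (P : System V H Ω ϱ) (y : ℝ → V) (g : ℝ → V →L[ℝ] ℝ) (w : ℝ → H) : Prop where
  memLp : MemLp y 2 timeMeasure
  memLp_deriv : MemLp g 2 timeMeasure
  continuousOn : ContinuousOn w (Icc 0 1)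
  ae_eq : ∀ᵐ t ∂timeMeasure, P.ι (y t) = w t
  eq_integral : ∀ t ∈ Icc (0 : ℝ) 1,
    P.toVDual (w t) = P.toVDual (w 0) + ∫ s in (0 : ℝ)..t, g s

/-- `y ∈ W(0,1)`, with continuous representative `w`, solves the state equation
`∂ₜ y + ν A y = ν B u`, `y(0) = y₀`. -/
def IsState (P : System V H Ω ϱ) (ν : ℝ) (u : Control ϱ) (y : ℝ → V) (w : ℝ → H) : Prop :=
  P.InW y (fun t => ν • (P.B (u t) - P.a (y t))) w ∧ w 0 = P.y0

/-- The observation `i₁ S(ν,u) = y(1)`, where `y = S(ν,u)` is the unique solution of the state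
equation. -/
def finalState (P : System V H Ω ϱ) (ν : ℝ) (u : Control ϱ) : H :=
  Classical.epsilon fun z => ∃ y w, P.IsState ν u y w ∧ w 1 = z

/-- The admissible controls `U_ad(0,1)`. -/
def Uad (P : System V H Ω ϱ) : Set (Control ϱ) :=
  {u | ∀ᵐ t ∂timeMeasure, ∀ᵐ x ∂ϱ, P.ua x ≤ (u t) x ∧ (u t) x ≤ P.ub x}

/-- The functional `f(ν,u) = ‖i₁ S(ν,u) - y_d‖ - δ₀`. -/
def f (P : System V H Ω ϱ) (ν : ℝ) (u : Control ϱ) : ℝ := ‖P.finalState ν u - P.yd‖ - P.δ₀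

/-- The set `ū(ν)` of distance-optimal controls, i.e. of the minimisers of
`‖i₁ S(ν,u) - y_d‖` over `U_ad(0,1)`. -/
def optControls (P : System V H Ω ϱ) (ν : ℝ) : Set (Control ϱ) :=
  {u | u ∈ P.Uad ∧ ∀ u' ∈ P.Uad, ‖P.finalState ν u - P.yd‖ ≤ ‖P.finalState ν u' - P.yd‖}

/-- `p ∈ W(0,1)` is the adjoint state of `(ν,u)`: `-∂ₜ p + ν A* p = 0` and
`p(1) = (y(1) - y_d) / ‖y(1) - y_d‖` for `y = S(ν,u)`, where `y(1) ≠ y_d`. -/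
def IsAdjointState (P : System V H Ω ϱ) (ν : ℝ) (u : Control ϱ) (p : ℝ → V) : Prop :=
  P.finalState ν u ≠ P.yd ∧
    ∃ w : ℝ → H, P.InW p (fun t => ν • P.a.flip (p t)) w ∧
      w 1 = ‖P.finalState ν u - P.yd‖⁻¹ • (P.finalState ν u - P.yd)

/-- The stability estimate `‖B*(p(ν₁) - p(ν₂))‖_{L^∞(I × ω)} ≤ c |ν₁ - ν₂|` for all
`ν₁, ν₂ ∈ [νmin, νmax]` and all `u ∈ U_ad(0,1)` (for which the adjoint states are defined). -/
def AdjointStability (P : System V H Ω ϱ) (νmin νmax c : ℝ) : Prop :=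
  ∀ ν₁ ∈ Icc νmin νmax, ∀ ν₂ ∈ Icc νmin νmax, ∀ u ∈ P.Uad, ∀ p₁ p₂ : ℝ → V,
    P.IsAdjointState ν₁ u p₁ → P.IsAdjointState ν₂ u p₂ →
      normLInf (fun t => P.Badj (p₁ t - p₂ t)) ≤ ENNReal.ofReal (c * |ν₁ - ν₂|)

/-- The growth condition at `(ν,u)`: the partial (Fréchet) derivative `∂ᵤ f(ν,u)` exists and
`∂ᵤ f(ν,u)(u' - u) ≥ ν c₀ ‖u' - u‖²_{L¹(I × ω)}` for all `u' ∈ U_ad(0,1)`. -/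
def GrowthCondition (P : System V H Ω ϱ) (ν : ℝ) (u : Control ϱ) (c₀ : ℝ) : Prop :=
  DifferentiableAt ℝ (P.f ν) u ∧
    ∀ u' ∈ P.Uad, ENNReal.ofReal (ν * c₀) * normL1 (u' - u) ^ 2 ≤
      ENNReal.ofReal (fderiv ℝ (P.f ν) u (u' - u))

end System

end ParabolicControl

end

noncomputable section

set_option linter.unusedSectionVars false

namespace ParabolicControl

/-! ### Gronwall inequality and energy estimates for `(ι* ι) y' + T y = F`. -/

open Real (exp)

/-! Let `u` be optimal for `ν`, `h = u - ubar`, and let `p₁`, `p₂` be the adjoint states of `(νbar,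
u)` and `(ν, u)`, both at the same control. Since `f(νbar, ·)` is convex, its derivative at `ubar`
along `h` is at most the pairing of `h` with the subgradient at `u`, namely `νbar ⟨h, B* p₁⟩`
(`fderiv_f_le`). Optimality of `u` gives `⟨h, B* p₂⟩ ≤ 0` (`inner_finalOp_nonneg`). With the growth
condition, adjoint stability and Hölder, `νbar c₀ ‖h‖₁² ≤ νbar ⟨h, B*(p₁ - p₂)⟩ ≤ νbar cs |ν - νbar|
‖h‖₁`; dividing by `‖h‖₁` gives the claim (`normL1_sub_le`).

Both adjoint states must exist. If the target is hit at `(νbar, ubar)`, the derivative there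
vanishes and the growth condition forces `u = ubar`. Otherwise every admissible control stays at a
positive distance from the target for `νbar`, and for nearby `ν` because the final state is
Lipschitz in `ν`, uniformly on bounded sets of controls. The growth condition itself makes `Uad`
bounded in `L²`, even when `ϱ` is infinite.

The state equation has to be solved as well. By the Riesz isomorphism it becomes `(ι* ι) y' + T y =
F` in `V`. Data of continuously differentiable curves are dense in `H × L²(I; V)`
(`denseRange_dataMap`), and the energy estimate extends the map from data to curve continuously to
all data. The equation, the duality with the backward problem and the perturbation formula are
checked on curves and pass to the limit. -/

theorem le_exp_mul_add_integral {N n b : ℝ → ℝ} {k : ℝ} (hk : 0 ≤ k) (hb : ∀ t, 0 ≤ b t)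
    (hbc : Continuous b) (hN : ContinuousOn N (Icc 0 1))
    (hd : ∀ t ∈ Ioo (0 : ℝ) 1, HasDerivAt N (n t) t)
    (hle : ∀ t ∈ Ioo (0 : ℝ) 1, n t ≤ k * N t + b t) {t : ℝ} (ht : t ∈ Icc (0 : ℝ) 1) :
    N t ≤ exp (k * t) * (N 0 + ∫ s in (0 : ℝ)..t, b s) := by
  have hI : ∀ t, HasDerivAt (fun t => ∫ s in (0 : ℝ)..t, b s) (b t) t := fun t =>
    (hbc.integral_hasStrictDerivAt 0 t).hasDerivAt
  have he : ∀ t, HasDerivAt (fun t => exp (-(k * t))) (exp (-(k * t)) * -k) t := fun t => by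
    simpa using (((hasDerivAt_id t).const_mul k).neg).exp
  -- Integrating factor; since `exp (-(k * t)) ≤ 1` and `b ≥ 0`, the source term needs no weight.
  have hanti : AntitoneOn (fun t => exp (-(k * t)) * N t - ∫ s in (0 : ℝ)..t, b s) (Icc 0 1) := by
    apply antitoneOn_of_hasDerivWithinAt_nonpos (convex_Icc 0 1)
      (f' := fun t => exp (-(k * t)) * -k * N t + exp (-(k * t)) * n t - b t)
    · refine ContinuousOn.sub (ContinuousOn.mul ?_ hN) ?_
      · fun_prop
      · exact fun t _ => (hI t).continuousAt.continuousWithinAt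
    · intro t ht
      rw [interior_Icc] at ht
      exact (((he t).mul (hd t ht)).sub (hI t)).hasDerivWithinAt
    · intro t ht
      rw [interior_Icc] at ht
      have h1 : exp (-(k * t)) ≤ 1 := by
        rw [Real.exp_le_one_iff]; nlinarith [mul_nonneg hk ht.1.le]
      have h2 := mul_le_mul_of_nonneg_left (hle t ht) (Real.exp_pos (-(k * t))).le
      have h3 := mul_le_mul_of_nonneg_right h1 (hb t)
      linarith
  have h := hanti (left_mem_Icc.2 zero_le_one) ht ht.1
  simp only [mul_zero, neg_zero, Real.exp_zero, one_mul, intervalIntegral.integral_same,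
    sub_zero] at h
  have h4 : exp (k * t) * exp (-(k * t)) = 1 := by rw [← Real.exp_add]; simp
  have h5 := mul_le_mul_of_nonneg_left (sub_le_iff_le_add.1 h) (Real.exp_pos (k * t)).le
  rwa [← mul_assoc, h4, one_mul] at h5

section Abstract

variable {V H : Type*}
  [NormedAddCommGroup V] [InnerProductSpace ℝ V] [CompleteSpace V]
  [NormedAddCommGroup H] [InnerProductSpace ℝ H] [CompleteSpace H]

/-- The Gram operator `ι* ι` on `V` of an embedding `ι : V → H`. -/
def gram (ι : V →L[ℝ] H) : V →L[ℝ] V := ContinuousLinearMap.adjoint ι ∘L ι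

theorem inner_gram (ι : V →L[ℝ] H) (u v : V) : ⟪gram ι u, v⟫ = ⟪ι u, ι v⟫ := by
  simp [gram, ContinuousLinearMap.adjoint_inner_left]

/-- By symmetry of the Gram operator, the slope of `‖ι Y‖²` equals the slope of `gram ι Y` paired
with `Y s + Y t`. So continuity of `Y` is enough, with no derivative of `Y` itself. -/
theorem hasDerivAt_norm_sq_of_gram (ι : V →L[ℝ] H) {Y : ℝ → V} {D : V} {t : ℝ}
    (hY : ContinuousAt Y t) (hM : HasDerivAt (fun s => gram ι (Y s)) D t) :
    HasDerivAt (fun s => ‖ι (Y s)‖ ^ 2) (2 * ⟪D, Y t⟫) t := by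
  rw [hasDerivAt_iff_tendsto_slope] at hM ⊢
  have h := hM.inner (𝕜 := ℝ) (((hY.tendsto.mono_left (nhdsWithin_le_nhds (s := {t}ᶜ))).add_const (Y t)))
  have e : 2 * ⟪D, Y t⟫ = ⟪D, Y t + Y t⟫ := by rw [inner_add_right]; ring
  rw [e]
  refine h.congr fun s => ?_
  simp only [slope_def_module, inner_smul_left, inner_gram, smul_eq_mul,
    inner_add_right, inner_sub_left, real_inner_self_eq_norm_sq]
  rw [real_inner_comm (ι (Y s)) (ι (Y t))]
  simp
  ring_nf

/-- The coercivity (Gårding) inequality for an operator `T` on `V`. -/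
def Garding (ι : V →L[ℝ] H) (T : V →L[ℝ] V) (α ω : ℝ) : Prop :=
  ∀ v : V, α * ‖v‖ ^ 2 ≤ ⟪T v, v⟫ + ω * ‖ι v‖ ^ 2

theorem Garding.adjoint {ι : V →L[ℝ] H} {T : V →L[ℝ] V} {α ω : ℝ} (h : Garding ι T α ω) :
    Garding ι (ContinuousLinearMap.adjoint T) α ω := fun v => by
  rw [ContinuousLinearMap.adjoint_inner_left, real_inner_comm]; exact h v

/-- Gronwall for `‖ι Y‖²`, which starts at zero and has derivative at most `2ω ‖ι Y‖²` by
coercivity. This is the uniqueness result behind both the density of data and the uniqueness of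
states. -/
theorem eq_zero_of_gram_eq_integral {ι : V →L[ℝ] H} (hι : Function.Injective ι) {T : V →L[ℝ] V}
    {α ω : ℝ} (hα : 0 < α) (hω : 0 ≤ ω) (hT : Garding ι T α ω) {Y : ℝ → V} (hY : Continuous Y)
    (h : ∀ t ∈ Icc (0 : ℝ) 1, gram ι (Y t) = -∫ s in (0 : ℝ)..t, T (Y s)) {t : ℝ}
    (ht : t ∈ Icc (0 : ℝ) 1) : Y t = 0 := by
  have hc : Continuous fun s => T (Y s) := T.continuous.comp hY
  have hd : ∀ t ∈ Ioo (0 : ℝ) 1, HasDerivAt (fun s => ‖ι (Y s)‖ ^ 2) (2 * ⟪-T (Y t), Y t⟫) t := by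
    intro t ht
    apply hasDerivAt_norm_sq_of_gram ι hY.continuousAt
    have : HasDerivAt (fun t => -∫ s in (0 : ℝ)..t, T (Y s)) (-T (Y t)) t :=
      (hc.integral_hasStrictDerivAt 0 t).hasDerivAt.neg
    refine this.congr_of_eventuallyEq ?_
    filter_upwards [Icc_mem_nhds ht.1 ht.2] with s hs using h s hs
  have h0 : ‖ι (Y 0)‖ ^ 2 = 0 := by
    rw [← real_inner_self_eq_norm_sq, ← inner_gram, h 0 (left_mem_Icc.2 zero_le_one)]; simp
  have := le_exp_mul_add_integral (b := fun _ => 0) (k := 2 * ω) (by positivity) (fun _ => le_rfl)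
    continuous_const (Continuous.continuousOn (by fun_prop)) hd (fun t _ => by
      have := hT (Y t)
      rw [inner_neg_left]
      nlinarith [mul_nonneg hα.le (sq_nonneg ‖Y t‖)]) ht
  simp only [h0, intervalIntegral.integral_zero, add_zero, mul_zero] at this
  apply hι
  simpa using this

/-- The continuously differentiable curve `t ↦ v + ∫₀ᵗ χ`. -/
def curve (v : V) (χ : C(ℝ, V)) (t : ℝ) : V := v + ∫ s in (0 : ℝ)..t, χ s

theorem hasDerivAt_curve (v : V) (χ : C(ℝ, V)) (t : ℝ) : HasDerivAt (curve v χ) (χ t) t :=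
  (χ.continuous.integral_hasStrictDerivAt 0 t).hasDerivAt.const_add v

theorem continuous_curve (v : V) (χ : C(ℝ, V)) : Continuous (curve v χ) :=
  continuous_iff_continuousAt.2 fun t => (hasDerivAt_curve v χ t).continuousAt

theorem curve_zero (v : V) (χ : C(ℝ, V)) : curve v χ 0 = v := by simp [curve]

/-- Pair the equation with the curve. Of the coercive term `2α ‖X‖²`, one half absorbs the forcing
by Young's inequality, whence the factor `α⁻¹`, and the other half controls the `L²(I; V)` norm. -/
theorem energy_estimate {ι : V →L[ℝ] H} {T : V →L[ℝ] V}
    {α ω : ℝ} (hα : 0 < α) (hω : 0 ≤ ω) (hT : Garding ι T α ω) (v : V) (χ : C(ℝ, V)) {t : ℝ}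
    (ht : t ∈ Icc (0 : ℝ) 1) :
    ‖ι (curve v χ t)‖ ^ 2 + α * ∫ s in (0 : ℝ)..t, ‖curve v χ s‖ ^ 2 ≤
      exp (2 * ω * t) * (‖ι v‖ ^ 2 +
        ∫ s in (0 : ℝ)..t, α⁻¹ * ‖gram ι (χ s) + T (curve v χ s)‖ ^ 2) := by
  have hX := continuous_curve v χ
  have hX2 : Continuous fun s => ‖curve v χ s‖ ^ 2 := by fun_prop
  have hI : ∀ t, HasDerivAt (fun t => ∫ s in (0 : ℝ)..t, ‖curve v χ s‖ ^ 2) (‖curve v χ t‖ ^ 2) t :=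
    fun t => (hX2.integral_hasStrictDerivAt 0 t).hasDerivAt
  have hd : ∀ t, HasDerivAt (fun t => ‖ι (curve v χ t)‖ ^ 2 +
      α * ∫ s in (0 : ℝ)..t, ‖curve v χ s‖ ^ 2)
      (2 * ⟪gram ι (χ t), curve v χ t⟫ + α * ‖curve v χ t‖ ^ 2) t := fun t =>
    (hasDerivAt_norm_sq_of_gram ι hX.continuousAt
      ((gram ι).hasFDerivAt.comp_hasDerivAt t (hasDerivAt_curve v χ t))).add ((hI t).const_mul α)
  have := le_exp_mul_add_integral (k := 2 * ω)
    (b := fun s => α⁻¹ * ‖gram ι (χ s) + T (curve v χ s)‖ ^ 2) (by positivity)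
    (fun t => by positivity) (by fun_prop)
    (fun t _ => (hd t).continuousAt.continuousWithinAt) (fun t _ => hd t) (fun t ht => by
      set F := gram ι (χ t) + T (curve v χ t) with hF
      set X := curve v χ t
      have h1 : gram ι (χ t) = F - T X := by rw [hF]; abel
      have h2 := hT X
      have h3 := real_inner_le_norm F X
      have h4 : 0 ≤ ∫ s in (0 : ℝ)..t, ‖curve v χ s‖ ^ 2 :=
        intervalIntegral.integral_nonneg ht.1.le fun s _ => by positivity
      have h5 : 2 * (‖F‖ * ‖X‖) ≤ α⁻¹ * ‖F‖ ^ 2 + α * ‖X‖ ^ 2 := by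
        have : 0 ≤ α⁻¹ * (‖F‖ - α * ‖X‖) ^ 2 := by positivity
        have e : α⁻¹ * (‖F‖ - α * ‖X‖) ^ 2 =
            α⁻¹ * ‖F‖ ^ 2 - 2 * (‖F‖ * ‖X‖) + α * ‖X‖ ^ 2 := by field_simp; ring
        linarith
      rw [h1, inner_sub_left]
      have h6 := mul_nonneg (mul_nonneg hω hα.le) h4
      nlinarith) ht
  simpa [curve_zero] using this

end Abstract

/-! ### Continuous functions in `L²(I; E)`. -/

section TimeLp

variable {E : Type*} [NormedAddCommGroup E]

theorem integral_timeMeasure [NormedSpace ℝ E] (f : ℝ → E) :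
    ∫ t, f t ∂timeMeasure = ∫ t in (0 : ℝ)..1, f t := by
  rw [intervalIntegral.integral_of_le zero_le_one, integral_Ioc_eq_integral_Ioo]

theorem ae_timeMeasure_mem : ∀ᵐ t ∂timeMeasure, t ∈ Ioo (0 : ℝ) 1 :=
  ae_restrict_mem measurableSet_Ioo

theorem _root_.Continuous.memLp_timeMeasure {f : ℝ → E} (hf : Continuous f) (p : ℝ≥0∞) :
    MemLp f p timeMeasure := by
  obtain ⟨C, hC⟩ := isCompact_Icc.exists_bound_of_continuousOn (s := Icc (0 : ℝ) 1) hf.continuousOn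
  refine MemLp.of_bound hf.aestronglyMeasurable C ?_
  filter_upwards [ae_timeMeasure_mem] with t ht using hC t (Ioo_subset_Icc_self ht)

variable [NormedSpace ℝ E]

/-- The class in `L²(I; E)` of a continuous function. -/
def contToLp : C(ℝ, E) →ₗ[ℝ] Lp E 2 timeMeasure where
  toFun f := (f.continuous.memLp_timeMeasure 2).toLp f
  map_add' _ _ := MemLp.toLp_add _ _
  map_smul' _ _ := MemLp.toLp_const_smul _ _

theorem coeFn_contToLp (f : C(ℝ, E)) : contToLp f =ᵐ[timeMeasure] f :=
  MemLp.coeFn_toLp (f.continuous.memLp_timeMeasure 2)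

theorem denseRange_contToLp : DenseRange (contToLp : C(ℝ, E) → Lp E 2 timeMeasure) := by
  refine (BoundedContinuousFunction.toLp_denseRange E timeMeasure (p := 2) ℝ
    ENNReal.ofNat_ne_top).mono ?_
  rintro _ ⟨f, rfl⟩
  refine ⟨f.toContinuousMap, ?_⟩
  refine Lp.ext ((coeFn_contToLp _).trans ?_)
  exact (BoundedContinuousFunction.coeFn_toLp 2 timeMeasure ℝ f).symm

end TimeLp

/-! ### Smooth curves and the density of their data. -/

section Abstract

variable {V H : Type*}
  [NormedAddCommGroup V] [InnerProductSpace ℝ V] [CompleteSpace V]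
  [NormedAddCommGroup H] [InnerProductSpace ℝ H] [CompleteSpace H]

theorem inner_contToLp (f : C(ℝ, V)) (G : Lp V 2 timeMeasure) :
    ⟪contToLp f, G⟫ = ∫ t, ⟪f t, G t⟫ ∂timeMeasure := by
  rw [L2.inner_def]
  refine integral_congr_ae ?_
  filter_upwards [coeFn_contToLp f] with t ht
  rw [ht]

/-- `curve` as a linear map into continuous functions. -/
def curveMap : V × C(ℝ, V) →ₗ[ℝ] C(ℝ, V) where
  toFun p := ⟨curve p.1 p.2, continuous_curve p.1 p.2⟩
  map_add' p q := by
    ext t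
    simp only [curve, Prod.fst_add, Prod.snd_add, ContinuousMap.coe_add, Pi.add_apply,
      ContinuousMap.coe_mk]
    rw [intervalIntegral.integral_add (p.2.continuous.intervalIntegrable _ _)
      (q.2.continuous.intervalIntegrable _ _)]
    abel
  map_smul' c p := by
    ext t
    simp [curve]

theorem curveMap_apply (p : V × C(ℝ, V)) (t : ℝ) : curveMap p t = curve p.1 p.2 t := rfl

/-- Composition with a continuous linear map, on continuous functions of time. -/
def compCont {E F : Type*} [NormedAddCommGroup E] [NormedSpace ℝ E] [NormedAddCommGroup F]
    [NormedSpace ℝ F] (L : E →L[ℝ] F) : C(ℝ, E) →ₗ[ℝ] C(ℝ, F) where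
  toFun f := ⟨fun t => L (f t), L.continuous.comp f.continuous⟩
  map_add' f g := by ext; simp
  map_smul' c f := by ext; simp

theorem compCont_apply {E F : Type*} [NormedAddCommGroup E] [NormedSpace ℝ E]
    [NormedAddCommGroup F] [NormedSpace ℝ F] (L : E →L[ℝ] F) (f : C(ℝ, E)) (t : ℝ) :
    compCont L f t = L (f t) := rfl

theorem contToLp_compCont {E F : Type*} [NormedAddCommGroup E] [NormedSpace ℝ E]
    [NormedAddCommGroup F] [NormedSpace ℝ F] (L : E →L[ℝ] F) (f : C(ℝ, E)) :
    contToLp (compCont L f) = L.compLpL 2 timeMeasure (contToLp f) := by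
  refine Lp.ext ?_
  filter_upwards [coeFn_contToLp (compCont L f), coeFn_contToLp f,
    L.coeFn_compLpL (contToLp f)] with t h1 h2 h3
  rw [h1, h3, h2, compCont_apply]

/-- The right hand side `(ι* ι) X' + T X` belonging to a curve `X`. -/
def forcing (ι : V →L[ℝ] H) (T : V →L[ℝ] V) : V × C(ℝ, V) →ₗ[ℝ] C(ℝ, V) :=
  compCont (gram ι) ∘ₗ LinearMap.snd ℝ _ _ + compCont T ∘ₗ curveMap

theorem forcing_apply (ι : V →L[ℝ] H) (T : V →L[ℝ] V) (p : V × C(ℝ, V)) (t : ℝ) :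
    forcing ι T p t = gram ι (p.2 t) + T (curve p.1 p.2 t) := rfl

/-- The space `H × L²(I; V)` of data (initial value and right hand side). -/
abbrev Data (V H : Type*) [NormedAddCommGroup V] [InnerProductSpace ℝ V]
    [NormedAddCommGroup H] [InnerProductSpace ℝ H] : Type _ :=
  WithLp 2 (H × Lp V 2 timeMeasure)

/-- The data of a continuously differentiable curve. -/
def dataMap (ι : V →L[ℝ] H) (T : V →L[ℝ] V) : V × C(ℝ, V) →ₗ[ℝ] Data V H :=
  (WithLp.linearEquiv 2 ℝ (H × Lp V 2 timeMeasure)).symm.toLinearMap ∘ₗ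
    LinearMap.prod (ι.toLinearMap ∘ₗ LinearMap.fst ℝ _ _) (contToLp ∘ₗ forcing ι T)

theorem dataMap_apply (ι : V →L[ℝ] H) (T : V →L[ℝ] V) (p : V × C(ℝ, V)) :
    dataMap ι T p = WithLp.toLp 2 (ι p.1, contToLp (forcing ι T p)) := rfl

/-- Fubini on the triangle `s ≤ t`; it moves the time integral from the test curve to `g`. -/
theorem integral_inner_curve_zero (χ : C(ℝ, V)) {g : ℝ → V} (hg : Integrable g) :
    ∫ t, ⟪curve 0 χ t, g t⟫ ∂timeMeasure =
      ∫ s, ⟪χ s, ∫ t in s..1, g t⟫ ∂timeMeasure := by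
  have hg' : Integrable g timeMeasure := hg.restrict
  have hχ : Integrable χ timeMeasure := memLp_one_iff_integrable.1 (χ.continuous.memLp_timeMeasure 1)
  have h1 : ∀ t ∈ Ioo (0 : ℝ) 1, ⟪curve 0 χ t, g t⟫ =
      ∫ s, (if s ≤ t then ⟪χ s, g t⟫ else 0) ∂timeMeasure := by
    intro t ht
    have : ∀ s, (if s ≤ t then ⟪χ s, g t⟫ else 0) = (Iic t).indicator (fun s => ⟪χ s, g t⟫) s :=
      fun s => by simp [indicator_apply]
    simp_rw [this]
    rw [integral_indicator measurableSet_Iic, Measure.restrict_restrict measurableSet_Iic]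
    have e : Iic t ∩ Ioo (0 : ℝ) 1 = Ioc 0 t := by
      ext s; simp only [mem_inter_iff, mem_Iic, mem_Ioo, mem_Ioc]
      constructor
      · rintro ⟨a, b, c⟩; exact ⟨b, a⟩
      · rintro ⟨a, b⟩; exact ⟨b, a, b.trans_lt ht.2⟩
    rw [e, curve, zero_add, intervalIntegral.integral_of_le ht.1.le]
    simp_rw [real_inner_comm (g t)]
    exact (integral_inner (χ.continuous.integrableOn_Ioc) (g t)).symm
  have h2 : ∀ s ∈ Ioo (0 : ℝ) 1, ⟪χ s, ∫ t in s..1, g t⟫ =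
      ∫ t, (if s ≤ t then ⟪χ s, g t⟫ else 0) ∂timeMeasure := by
    intro s hs
    have : ∀ t, (if s ≤ t then ⟪χ s, g t⟫ else 0) = (Ici s).indicator (fun t => ⟪χ s, g t⟫) t :=
      fun t => by simp [indicator_apply]
    simp_rw [this]
    rw [integral_indicator measurableSet_Ici, Measure.restrict_restrict measurableSet_Ici]
    have e : Ici s ∩ Ioo (0 : ℝ) 1 = Ico s 1 := by
      ext t; simp only [mem_inter_iff, mem_Ici, mem_Ioo, mem_Ico]
      constructor
      · rintro ⟨a, b, c⟩; exact ⟨a, c⟩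
      · rintro ⟨a, b⟩; exact ⟨a, hs.1.trans_le a, b⟩
    rw [e, intervalIntegral.integral_of_le hs.2.le, integral_Ioc_eq_integral_Ioo,
      ← integral_Ico_eq_integral_Ioo]
    exact (integral_inner hg.integrableOn (χ s)).symm
  rw [integral_congr_ae (ae_timeMeasure_mem.mono h1), integral_congr_ae (ae_timeMeasure_mem.mono h2)]
  apply integral_integral_swap
  have hm : MeasurableSet {z : ℝ × ℝ | z.2 ≤ z.1} := measurableSet_le measurable_snd measurable_fst
  have : Function.uncurry (fun t s => if s ≤ t then ⟪χ s, g t⟫ else 0) =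
      {z : ℝ × ℝ | z.2 ≤ z.1}.indicator fun z => ⟪χ z.2, g z.1⟫ := by
    ext z; simp [indicator_apply, Function.uncurry]
  rw [this]
  refine Integrable.indicator ?_ hm
  refine (hg'.norm.mul_prod hχ.norm).mono
    (hχ.aestronglyMeasurable.comp_snd.inner hg'.aestronglyMeasurable.comp_fst) ?_
  refine Filter.Eventually.of_forall fun z => ?_
  rw [norm_mul, norm_norm, norm_norm, mul_comm]
  exact norm_inner_le_norm _ _

/-- Let `(z, G)` be orthogonal to the range. Curves starting at zero yield `gram ι G + T* Γ = 0`
with `Γ t = ∫ₜ¹ G`. Integrated, this is a homogeneous backward equation for `Γ`, so `Γ = 0` and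
hence `G = 0`. Varying the initial value and using that `ι` has dense range gives `z = 0`. -/
theorem denseRange_dataMap {ι : V →L[ℝ] H} (hι : Function.Injective ι) (hd : DenseRange ι)
    {T : V →L[ℝ] V} {α ω : ℝ} (hα : 0 < α) (hω : 0 ≤ ω) (hT : Garding ι T α ω) :
    DenseRange (dataMap ι T) := by
  have hdr : Dense ((LinearMap.range (dataMap ι T) : Submodule ℝ (Data V H)) : Set (Data V H)) := by
    rw [Submodule.dense_iff_topologicalClosure_eq_top, Submodule.topologicalClosure_eq_top_iff,
      Submodule.eq_bot_iff]
    intro z hz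
    have hz' : ∀ p : V × C(ℝ, V),
        ⟪ι p.1, z.fst⟫ + ⟪contToLp (forcing ι T p), z.snd⟫ = 0 := fun p => by
      have := hz _ (LinearMap.mem_range_self (dataMap ι T) p)
      rw [WithLp.prod_inner_apply, dataMap_apply] at this
      exact this
    set G := z.snd with hG
    -- Extension by zero makes the primitive continuous on all of `ℝ`.
    set g : ℝ → V := (Ioo (0 : ℝ) 1).indicator G with hg
    have hgG : g =ᵐ[timeMeasure] G := indicator_ae_eq_restrict measurableSet_Ioo
    have hgi : Integrable g := by
      rw [hg, integrable_indicator_iff measurableSet_Ioo]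
      exact (Lp.memLp G).integrable one_le_two
    have hΓc : Continuous fun s => ∫ t in s..1, g t := by
      have := (intervalIntegral.continuous_primitive (fun a b => hgi.intervalIntegrable) (1 : ℝ)).neg
      refine this.congr fun s => ?_
      rw [Pi.neg_apply, ← intervalIntegral.integral_symm]
    set Γ : C(ℝ, V) := ⟨_, hΓc⟩ with hΓ
    set K : Lp V 2 timeMeasure := (gram ι).compLpL 2 timeMeasure G +
      contToLp (compCont (ContinuousLinearMap.adjoint T) Γ) with hK
    have hK_ae : ∀ᵐ t ∂timeMeasure,
        K t = gram ι (g t) + ContinuousLinearMap.adjoint T (Γ t) := by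
      filter_upwards [hgG, Lp.coeFn_add ((gram ι).compLpL 2 timeMeasure G)
        (contToLp (compCont (ContinuousLinearMap.adjoint T) Γ)), coeFn_contToLp
        (compCont (ContinuousLinearMap.adjoint T) Γ), (gram ι).coeFn_compLpL G] with t h1 h2 h3 h4
      rw [h2, Pi.add_apply, h3, h4, h1, compCont_apply]
    have hK0 : K = 0 := by
      refine Dense.eq_zero_of_inner_left ℝ denseRange_contToLp ?_
      rintro _ ⟨χ, rfl⟩
      have h0 := hz' (0, χ)
      rw [map_zero, inner_zero_left, zero_add, inner_contToLp] at h0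
      have i1 : Integrable (fun t => ⟪gram ι (χ t), g t⟫) timeMeasure := by
        have := L2.integrable_inner (𝕜 := ℝ) (contToLp (compCont (gram ι) χ)) G
        refine this.congr ?_
        filter_upwards [coeFn_contToLp (compCont (gram ι) χ), hgG] with t h1 h2
        rw [h1, h2, compCont_apply]
      have i2 : Integrable (fun t => ⟪T (curve 0 χ t), g t⟫) timeMeasure := by
        have := L2.integrable_inner (𝕜 := ℝ) (contToLp (compCont T (curveMap (0, χ)))) G
        refine this.congr ?_
        filter_upwards [coeFn_contToLp (compCont T (curveMap (0, χ))), hgG] with t h1 h2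
        rw [h1, h2, compCont_apply, curveMap_apply]
      have i3 : Integrable (fun t => ⟪T (χ t), Γ t⟫) timeMeasure :=
        memLp_one_iff_integrable.1 (Continuous.memLp_timeMeasure (by fun_prop) 1)
      have e1 : ∫ t, ⟪T (curve 0 χ t), g t⟫ ∂timeMeasure =
          ∫ t, ⟪T (χ t), Γ t⟫ ∂timeMeasure := by
        refine Eq.trans ?_ (integral_inner_curve_zero (compCont T χ) hgi)
        refine integral_congr_ae (Filter.Eventually.of_forall fun t => ?_)
        simp only [curve, zero_add, compCont_apply]
        rw [T.intervalIntegral_comp_comm (χ.continuous.intervalIntegrable _ _)]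
      have e2 : ∫ t, ⟪forcing ι T (0, χ) t, G t⟫ ∂timeMeasure =
          ∫ t, (⟪gram ι (χ t), g t⟫ + ⟪T (curve 0 χ t), g t⟫) ∂timeMeasure := by
        refine integral_congr_ae ?_
        filter_upwards [hgG] with t h1
        rw [← h1, forcing_apply, inner_add_left]
      rw [e2, integral_add i1 i2, e1, ← integral_add i1 i3] at h0
      rw [real_inner_comm, inner_contToLp, ← h0]
      refine integral_congr_ae ?_
      filter_upwards [hK_ae] with t h1
      rw [h1, inner_add_right, ContinuousLinearMap.adjoint_inner_right, inner_gram,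
        real_inner_comm, inner_gram, real_inner_comm]
    have hae : ∀ᵐ t ∂timeMeasure,
        gram ι (g t) = -ContinuousLinearMap.adjoint T (Γ t) := by
      filter_upwards [hK_ae, Lp.coeFn_zero V 2 timeMeasure] with t h1 h2
      rw [hK0, h2] at h1
      exact eq_neg_of_add_eq_zero_left h1.symm
    have hΓ0 : ∀ t ∈ Icc (0 : ℝ) 1, Γ t = 0 := by
      intro t ht
      -- Reversed in time, `Γ` starts at zero and solves the forward equation for `T*`.
      have := eq_zero_of_gram_eq_integral hι hα hω hT.adjoint (Y := fun s => Γ (1 - s))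
        (by fun_prop) (fun s hs => ?_) (t := 1 - t) ⟨by linarith [ht.2], by linarith [ht.1]⟩
      · simpa using this
      · rw [intervalIntegral.integral_comp_sub_left
          (fun s => ContinuousLinearMap.adjoint T (Γ s)) 1, sub_zero]
        change gram ι (∫ t in (1 - s)..1, g t) = _
        rw [← ContinuousLinearMap.intervalIntegral_comp_comm _ hgi.intervalIntegrable,
          ← intervalIntegral.integral_neg]
        refine intervalIntegral.integral_congr_ae ?_
        have h3 := ae_imp_of_ae_restrict hae
        have h4 : ∀ᵐ t : ℝ, t ≠ 1 := by simp [ae_iff]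
        filter_upwards [h3, h4] with t h3 h4 ht
        rw [uIoc_of_le (by linarith [hs.1])] at ht
        exact h3 ⟨by linarith [ht.1, hs.2], lt_of_le_of_ne ht.2 h4⟩
    have hG0 : G = 0 := by
      refine Lp.ext ?_
      filter_upwards [hae, ae_timeMeasure_mem, hgG, Lp.coeFn_zero V 2 timeMeasure] with t h1 h2 h3 h4
      rw [hΓ0 t (Ioo_subset_Icc_self h2), map_zero, neg_zero] at h1
      rw [h4, ← h3]
      apply hι
      have : ‖ι (g t)‖ ^ 2 = 0 := by
        rw [← real_inner_self_eq_norm_sq, ← inner_gram, h1, inner_zero_left]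
      simpa using this
    have hh0 : z.fst = 0 := by
      refine Dense.eq_zero_of_inner_left ℝ hd ?_
      rintro _ ⟨v, rfl⟩
      have := hz' (v, 0)
      rw [hG0, inner_zero_right, add_zero] at this
      rw [real_inner_comm]; exact this
    apply (WithLp.linearEquiv 2 ℝ (H × Lp V 2 timeMeasure)).injective
    rw [map_zero]
    exact Prod.ext hh0 hG0
  exact hdr

end Abstract

theorem setIntegral_Ioc_timeMeasure {E : Type*} [NormedAddCommGroup E] [NormedSpace ℝ E]
    (f : ℝ → E) {t : ℝ} (ht : t ∈ Icc (0 : ℝ) 1) :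
    ∫ s in Ioc 0 t, f s ∂timeMeasure = ∫ s in (0 : ℝ)..t, f s := by
  rw [intervalIntegral.integral_of_le ht.1, Measure.restrict_restrict measurableSet_Ioc,
    integral_Ioc_eq_integral_Ioo]
  have h : (Ioc 0 t ∩ Ioo 0 1 : Set ℝ) =ᵐ[volume] Ioo 0 t := by
    have : (Ioo 0 t : Set ℝ) = Ioo 0 t ∩ Ioo 0 1 := by
      rw [Ioo_inter_Ioo, sup_idem, inf_eq_left.2 ht.2]
    rw [this]
    exact Ioo_ae_eq_Ioc.symm.inter (ae_eq_refl _)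
  exact setIntegral_congr_set h

/-! ### The solution operator and the equation it solves. -/

section Abstract

variable {V H : Type*}
  [NormedAddCommGroup V] [InnerProductSpace ℝ V] [CompleteSpace V]
  [NormedAddCommGroup H] [InnerProductSpace ℝ H] [CompleteSpace H]

theorem norm_contToLp_sq (f : C(ℝ, V)) : ‖contToLp f‖ ^ 2 = ∫ t in (0 : ℝ)..1, ‖f t‖ ^ 2 := by
  rw [← real_inner_self_eq_norm_sq, inner_contToLp, ← integral_timeMeasure]
  refine integral_congr_ae ?_
  filter_upwards [coeFn_contToLp f] with t ht
  rw [ht, real_inner_self_eq_norm_sq]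

/-- The standing assumptions on an abstract parabolic problem `(ι* ι) y' + T y = F`. -/
structure Parabolic (ι : V →L[ℝ] H) (T : V →L[ℝ] V) (α ω : ℝ) : Prop where
  injective : Function.Injective ι
  dense : DenseRange ι
  α_pos : 0 < α
  ω_nonneg : 0 ≤ ω
  garding : Garding ι T α ω

theorem Parabolic.adjoint {ι : V →L[ℝ] H} {T : V →L[ℝ] V} {α ω : ℝ} (h : Parabolic ι T α ω) :
    Parabolic ι (ContinuousLinearMap.adjoint T) α ω :=
  ⟨h.injective, h.dense, h.α_pos, h.ω_nonneg, h.garding.adjoint⟩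

/-- A differentiable curve, as an element of `C([0,1]; H) × L²(I; V)`. -/
def curveClass (ι : V →L[ℝ] H) :
    V × C(ℝ, V) →ₗ[ℝ] C(Icc (0 : ℝ) 1, H) × Lp V 2 timeMeasure where
  toFun p := ((compCont ι (curveMap p)).restrict (Icc 0 1), contToLp (curveMap p))
  map_add' p q := by
    simp only [map_add]; rfl
  map_smul' c p := by
    simp only [map_smul]; rfl

theorem curveClass_fst_apply (ι : V →L[ℝ] H) (p : V × C(ℝ, V)) (t : Icc (0 : ℝ) 1) :
    (curveClass ι p).1 t = ι (curve p.1 p.2 t) := rfl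

theorem curveClass_snd (ι : V →L[ℝ] H) (p : V × C(ℝ, V)) :
    (curveClass ι p).2 = contToLp (curveMap p) := rfl

/-- The bound for the solution operator. -/
def solutionBound (α ω : ℝ) : ℝ := (1 + α⁻¹) * exp ω

variable {ι : V →L[ℝ] H} {T : V →L[ℝ] V} {α ω : ℝ}

theorem Parabolic.solutionBound_nonneg (h : Parabolic ι T α ω) : 0 ≤ solutionBound α ω := by
  have := h.α_pos
  unfold solutionBound; positivity

theorem Parabolic.norm_curveClass_le (h : Parabolic ι T α ω) (p : V × C(ℝ, V)) :
    ‖curveClass ι p‖ ≤ solutionBound α ω * ‖dataMap ι T p‖ := by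
  have hα := h.α_pos
  set R := ‖dataMap ι T p‖ with hR
  have hR2 : R ^ 2 = ‖ι p.1‖ ^ 2 + ‖contToLp (forcing ι T p)‖ ^ 2 :=
    WithLp.prod_norm_sq_eq_of_L2 _
  have hF : ∀ a b, IntervalIntegrable (fun s => α⁻¹ * ‖forcing ι T p s‖ ^ 2) volume a b := fun a b =>
    Continuous.intervalIntegrable (by fun_prop) _ _
  have key : ∀ t ∈ Icc (0 : ℝ) 1, ‖ι (curve p.1 p.2 t)‖ ^ 2 +
      α * ∫ s in (0 : ℝ)..t, ‖curve p.1 p.2 s‖ ^ 2 ≤ exp (2 * ω) * ((1 + α⁻¹) * R ^ 2) := by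
    intro t ht
    refine (energy_estimate hα h.ω_nonneg h.garding p.1 p.2 ht).trans ?_
    have h1 : exp (2 * ω * t) ≤ exp (2 * ω) :=
      Real.exp_le_exp.2 (by nlinarith [h.ω_nonneg, ht.2])
    have h2 : ∫ s in (0 : ℝ)..t, α⁻¹ * ‖gram ι (p.2 s) + T (curve p.1 p.2 s)‖ ^ 2 ≤
        α⁻¹ * ‖contToLp (forcing ι T p)‖ ^ 2 := by
      rw [norm_contToLp_sq, ← intervalIntegral.integral_const_mul,
        ← intervalIntegral.integral_add_adjacent_intervals (hF 0 t) (hF t 1)]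
      have : 0 ≤ ∫ s in t..1, α⁻¹ * ‖forcing ι T p s‖ ^ 2 :=
        intervalIntegral.integral_nonneg ht.2 fun s _ => by positivity
      simp only [forcing_apply] at this ⊢
      linarith
    have h3 : 0 ≤ ∫ s in (0 : ℝ)..t, α⁻¹ * ‖gram ι (p.2 s) + T (curve p.1 p.2 s)‖ ^ 2 :=
      intervalIntegral.integral_nonneg ht.1 fun s _ => by positivity
    refine mul_le_mul h1 ?_ (by positivity) (by positivity)
    have h4 : 0 ≤ α⁻¹ * ‖ι p.1‖ ^ 2 := by positivity
    have h5 : 0 ≤ ‖contToLp (forcing ι T p)‖ ^ 2 := by positivity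
    rw [hR2]
    linarith
  -- With `Q` the right side of `key`, the squared sup norm is at most `Q` and the squared `L²(I;
  -- V)` norm at most `α⁻¹ Q`; the factor `1 + α⁻¹` covers both.
  have hC : (solutionBound α ω * R) ^ 2 = (1 + α⁻¹) * (exp (2 * ω) * ((1 + α⁻¹) * R ^ 2)) := by
    rw [solutionBound, two_mul, Real.exp_add]; ring
  have hpos : 0 ≤ exp (2 * ω) * ((1 + α⁻¹) * R ^ 2) := by positivity
  have hinv : 0 < α⁻¹ := by positivity
  have hCR : 0 ≤ solutionBound α ω * R := mul_nonneg h.solutionBound_nonneg (norm_nonneg _)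
  rw [Prod.norm_def, max_le_iff]
  constructor
  · rw [ContinuousMap.norm_le _ hCR]
    intro t
    rw [curveClass_fst_apply]
    refine abs_le_of_sq_le_sq' ?_ hCR |>.2
    rw [hC]
    have h1 := key t t.2
    have h2 : 0 ≤ ∫ s in (0 : ℝ)..t, ‖curve p.1 p.2 s‖ ^ 2 :=
      intervalIntegral.integral_nonneg t.2.1 fun s _ => by positivity
    nlinarith [mul_nonneg hα.le h2, mul_nonneg hinv.le hpos]
  · refine abs_le_of_sq_le_sq' ?_ hCR |>.2
    rw [hC, curveClass_snd, norm_contToLp_sq]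
    have h1 := key 1 ⟨zero_le_one, le_rfl⟩
    have h2 := mul_le_mul_of_nonneg_left h1 hinv.le
    rw [mul_add, ← mul_assoc, inv_mul_cancel₀ hα.ne', one_mul] at h2
    have h3 : 0 ≤ α⁻¹ * ‖ι (curve p.1 p.2 1)‖ ^ 2 := by positivity
    simp only [curveMap_apply]
    linarith

/-- The solution operator of `(ι* ι) y' + T y = F`, `y(0) = y₀`, from the data `(y₀, F)` to
the pair of the continuous representative in `C([0,1]; H)` and the class in `L²(I; V)`. -/
def solutionOp (ι : V →L[ℝ] H) (T : V →L[ℝ] V) :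
    Data V H →L[ℝ] C(Icc (0 : ℝ) 1, H) × Lp V 2 timeMeasure :=
  (curveClass ι).extendOfNorm (dataMap ι T)

theorem Parabolic.denseRange (h : Parabolic ι T α ω) : DenseRange (dataMap ι T) :=
  denseRange_dataMap h.injective h.dense h.α_pos h.ω_nonneg h.garding

theorem Parabolic.solutionOp_dataMap (h : Parabolic ι T α ω) (p : V × C(ℝ, V)) :
    solutionOp ι T (dataMap ι T p) = curveClass ι p :=
  LinearMap.extendOfNorm_eq h.denseRange ⟨_, h.norm_curveClass_le⟩ p

theorem Parabolic.norm_solutionOp_apply_le (h : Parabolic ι T α ω) (k : Data V H) :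
    ‖solutionOp ι T k‖ ≤ solutionBound α ω * ‖k‖ :=
  LinearMap.norm_extendOfNorm_apply_le h.denseRange _ h.norm_curveClass_le k

/-- The class in `L²(I; H)` of an element of `C([0,1]; H)`. -/
def restrictedToLp : C(Icc (0 : ℝ) 1, H) →L[ℝ] Lp H 2 timeMeasure :=
  LinearMap.mkContinuous
    { toFun := fun w => contToLp ⟨IccExtend zero_le_one w, w.continuous.Icc_extend'⟩
      map_add' := fun w w' => by rw [← map_add]; rfl
      map_smul' := fun c w => by rw [RingHom.id_apply, ← map_smul]; rfl }
    ((measureUnivNNReal timeMeasure : ℝ) ^ (2 : ℝ≥0∞).toReal⁻¹) fun w => by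
      refine Lp.norm_le_of_ae_bound (norm_nonneg _) ?_
      filter_upwards [coeFn_contToLp
        (⟨IccExtend zero_le_one w, w.continuous.Icc_extend'⟩ : C(ℝ, H))] with t ht
      exact (congrArg norm ht).trans_le (w.norm_coe_le_norm _)

theorem coeFn_restrictedToLp (w : C(Icc (0 : ℝ) 1, H)) :
    restrictedToLp w =ᵐ[timeMeasure] IccExtend zero_le_one w :=
  coeFn_contToLp ⟨IccExtend zero_le_one w, w.continuous.Icc_extend'⟩

theorem Parabolic.solutionOp_ae_eq (h : Parabolic ι T α ω) (k : Data V H) :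
    ∀ᵐ t ∂timeMeasure, ι ((solutionOp ι T k).2 t) =
      IccExtend zero_le_one (solutionOp ι T k).1 t := by
  have : ι.compLpL 2 timeMeasure (solutionOp ι T k).2 = restrictedToLp (solutionOp ι T k).1 := by
    refine h.denseRange.induction_on (p := fun k =>
      ι.compLpL 2 timeMeasure (solutionOp ι T k).2 = restrictedToLp (solutionOp ι T k).1) k
      (isClosed_eq (by fun_prop) (by fun_prop)) fun p => ?_
    rw [h.solutionOp_dataMap, curveClass_snd, ← contToLp_compCont]
    refine Lp.ext ?_
    filter_upwards [coeFn_contToLp (compCont ι (curveMap p)),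
      coeFn_restrictedToLp (curveClass ι p).1, ae_timeMeasure_mem] with t h1 h2 h3
    rw [h1, h2, IccExtend_of_mem _ _ (Ioo_subset_Icc_self h3)]
    rfl
  filter_upwards [ι.coeFn_compLpL (solutionOp ι T k).2,
    coeFn_restrictedToLp (solutionOp ι T k).1] with t h1 h2
  rw [← h1, this, h2]

theorem Parabolic.solutionOp_zero (h : Parabolic ι T α ω) (k : Data V H) :
    (solutionOp ι T k).1 ⟨0, left_mem_Icc.2 zero_le_one⟩ = k.fst := by
  refine h.denseRange.induction_on (p := fun k =>
      (solutionOp ι T k).1 ⟨0, left_mem_Icc.2 zero_le_one⟩ = k.fst) k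
      (isClosed_eq ?_ ?_) fun p => ?_
  · exact (ContinuousMap.evalCLM ℝ _).continuous.comp
      (continuous_fst.comp (solutionOp ι T).continuous)
  · exact (WithLp.prod_continuous_ofLp 2 _ _).fst
  · rw [h.solutionOp_dataMap, curveClass_fst_apply, curve_zero]
    rfl

/-- Tested against `v`, the integral over `(0, t)` is an `L²` inner product with an indicator
function, so the identity is closed in `k` and need only be checked on curves, where it is the
fundamental theorem of calculus. -/
theorem Parabolic.solutionOp_equation (h : Parabolic ι T α ω) (k : Data V H) {g : ℝ → V}
    (hg : ∀ᵐ t ∂timeMeasure, g t = k.snd t - T ((solutionOp ι T k).2 t))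
    (t : Icc (0 : ℝ) 1) :
    ContinuousLinearMap.adjoint ι ((solutionOp ι T k).1 t) =
      ContinuousLinearMap.adjoint ι k.fst + ∫ s in (0 : ℝ)..t, g s := by
  have key : ∀ v : V, ⟪v, ContinuousLinearMap.adjoint ι ((solutionOp ι T k).1 t)⟫ =
      ⟪v, ContinuousLinearMap.adjoint ι k.fst⟫ +
        ⟪indicatorConstLp (μ := timeMeasure) 2 measurableSet_Ioc (measure_ne_top _ (Ioc 0 (t : ℝ))) v,
          k.snd - T.compLpL 2 timeMeasure (solutionOp ι T k).2⟫ := by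
    intro v
    refine h.denseRange.induction_on (p := fun k =>
      ⟪v, ContinuousLinearMap.adjoint ι ((solutionOp ι T k).1 t)⟫ =
      ⟪v, ContinuousLinearMap.adjoint ι k.fst⟫ +
        ⟪indicatorConstLp (μ := timeMeasure) 2 measurableSet_Ioc (measure_ne_top _ (Ioc 0 (t : ℝ))) v,
          k.snd - T.compLpL 2 timeMeasure (solutionOp ι T k).2⟫) k
      (isClosed_eq ?_ ?_) fun p => ?_
    · have : Continuous fun k => (solutionOp ι T k).1 t :=
        (ContinuousMap.evalCLM ℝ t).continuous.comp
          (continuous_fst.comp (solutionOp ι T).continuous)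
      fun_prop
    · have h1 : Continuous fun k : Data V H => k.fst := (WithLp.prod_continuous_ofLp 2 _ _).fst
      have h2 : Continuous fun k : Data V H => k.snd := (WithLp.prod_continuous_ofLp 2 _ _).snd
      fun_prop
    · rw [h.solutionOp_dataMap, curveClass_fst_apply, curveClass_snd, ← contToLp_compCont]
      change _ = ⟪v, ContinuousLinearMap.adjoint ι (ι p.1)⟫ + ⟪_, contToLp (forcing ι T p) - _⟫
      rw [← map_sub, L2.inner_indicatorConstLp_eq_inner_setIntegral, ← inner_add_right]
      congr 1
      rw [setIntegral_congr_ae measurableSet_Ioc (g := fun s => gram ι (p.2 s)) ?_,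
        setIntegral_Ioc_timeMeasure _ t.2, ContinuousLinearMap.intervalIntegral_comp_comm _
          (p.2.continuous.intervalIntegrable _ _), ← ContinuousLinearMap.comp_apply,
        ← ContinuousLinearMap.comp_apply]
      · change gram ι _ = gram ι _ + _
        rw [← map_add]; rfl
      · filter_upwards [coeFn_contToLp (forcing ι T p - compCont T (curveMap p))] with s hs _
        rw [hs]
        simp [forcing_apply, compCont_apply, curveMap_apply]
  refine ext_inner_left ℝ fun v => ?_
  rw [key v, L2.inner_indicatorConstLp_eq_inner_setIntegral, ← inner_add_right,
    ← setIntegral_Ioc_timeMeasure _ t.2]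
  congr 2
  refine integral_congr_ae (ae_restrict_of_ae ?_)
  filter_upwards [hg, Lp.coeFn_sub k.snd (T.compLpL 2 timeMeasure (solutionOp ι T k).2),
    T.coeFn_compLpL (solutionOp ι T k).2] with s h1 h2 h3
  rw [h1, h2, Pi.sub_apply, h3]

end Abstract

/-! ### Time reversal, duality, perturbation of the operator, uniqueness. -/

theorem measurePreserving_one_sub :
    MeasurePreserving (fun t : ℝ => 1 - t) timeMeasure timeMeasure := by
  have := (Measure.measurePreserving_sub_left (volume : Measure ℝ) 1).restrict_preimage
    (measurableSet_Ioo (a := (0 : ℝ)) (b := 1))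
  have e : (fun t : ℝ => 1 - t) ⁻¹' Ioo 0 1 = Ioo 0 1 := by
    ext t; simp only [mem_preimage, mem_Ioo]; constructor <;> rintro ⟨a, b⟩ <;> constructor <;> linarith
  rwa [e] at this

section Abstract

variable {V H : Type*}
  [NormedAddCommGroup V] [InnerProductSpace ℝ V] [CompleteSpace V]
  [NormedAddCommGroup H] [InnerProductSpace ℝ H] [CompleteSpace H]

/-- Reversal of time on `L²(I; V)`. -/
def timeReverse : Lp V 2 timeMeasure →L[ℝ] Lp V 2 timeMeasure :=
  (Lp.compMeasurePreservingₗᵢ ℝ _ measurePreserving_one_sub).toContinuousLinearMap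

theorem coeFn_timeReverse (f : Lp V 2 timeMeasure) :
    timeReverse f =ᵐ[timeMeasure] fun t => f (1 - t) :=
  Lp.coeFn_compMeasurePreserving f measurePreserving_one_sub

/-- Reversal of time for continuous functions. -/
def reverseCont (f : C(ℝ, V)) : C(ℝ, V) := ⟨fun t => f (1 - t), by fun_prop⟩

theorem timeReverse_contToLp (f : C(ℝ, V)) : timeReverse (contToLp f) = contToLp (reverseCont f) := by
  refine Lp.ext ?_
  filter_upwards [coeFn_timeReverse (contToLp f), coeFn_contToLp (reverseCont f),
    measurePreserving_one_sub.quasiMeasurePreserving.ae (coeFn_contToLp f)] with t h1 h2 h3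
  rw [h1, h2, h3]; rfl

variable {ι : V →L[ℝ] H} {T : V →L[ℝ] V} {α ω : ℝ}

/-- The endpoint `1` of the time interval. -/
def endTime : Icc (0 : ℝ) 1 := ⟨1, right_mem_Icc.2 zero_le_one⟩

theorem inner_contToLp_contToLp (f g : C(ℝ, V)) :
    ⟪contToLp f, contToLp g⟫ = ∫ t in (0 : ℝ)..1, ⟪f t, g t⟫ := by
  rw [inner_contToLp, ← integral_timeMeasure]
  refine integral_congr_ae ?_
  filter_upwards [coeFn_contToLp g] with t ht
  rw [ht]

/-- Integration by parts for smooth curves, against a curve with reversed time. -/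
theorem inner_curve_duality (ι : V →L[ℝ] H) (T : V →L[ℝ] V) (p q : V × C(ℝ, V)) :
    ⟪ι (curve p.1 p.2 1), ι q.1⟫ - ⟪ι p.1, ι (curve q.1 q.2 1)⟫ =
      ⟪contToLp (forcing ι T p), timeReverse (contToLp (curveMap q))⟫ -
        ⟪contToLp (curveMap p),
          timeReverse (contToLp (forcing ι (ContinuousLinearMap.adjoint T) q))⟫ := by
  rw [timeReverse_contToLp, timeReverse_contToLp, inner_contToLp_contToLp, inner_contToLp_contToLp]
  rw [← intervalIntegral.integral_sub (Continuous.intervalIntegrable (by fun_prop) _ _)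
    (Continuous.intervalIntegrable (by fun_prop) _ _)]
  have hd : ∀ t ∈ uIcc (0 : ℝ) 1, HasDerivAt
      (fun t => ⟪ι (curve p.1 p.2 t), ι (curve q.1 q.2 (1 - t))⟫)
      (⟪forcing ι T p t, reverseCont (curveMap q) t⟫ - ⟪curveMap p t,
        reverseCont (forcing ι (ContinuousLinearMap.adjoint T) q) t⟫) t := by
    intro t _
    have h1 := ι.hasFDerivAt.comp_hasDerivAt t (hasDerivAt_curve p.1 p.2 t)
    have h2 : HasDerivAt (fun t => curve q.1 q.2 (1 - t)) (-q.2 (1 - t)) t := by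
      have := (hasDerivAt_curve q.1 q.2 (1 - t)).scomp t ((hasDerivAt_id t).const_sub 1)
      simpa [Function.comp_def] using this
    have h3 := h1.inner ℝ (ι.hasFDerivAt.comp_hasDerivAt t h2)
    refine h3.congr_deriv ?_
    change _ = ⟪gram ι (p.2 t) + T (curve p.1 p.2 t), curve q.1 q.2 (1 - t)⟫ -
      ⟪curve p.1 p.2 t, gram ι (q.2 (1 - t)) +
        ContinuousLinearMap.adjoint T (curve q.1 q.2 (1 - t))⟫
    rw [inner_add_left, inner_add_right, ContinuousLinearMap.adjoint_inner_right, inner_gram,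
      real_inner_comm (gram ι _), inner_gram, map_neg, inner_neg_right,
      real_inner_comm (ι (q.2 (1 - t)))]
    simp only [Function.comp_apply]
    ring
  rw [intervalIntegral.integral_eq_sub_of_hasDerivAt hd
    (Continuous.intervalIntegrable (by fun_prop) _ _)]
  simp [curve_zero]

/-- Green's formula between the forward problem and the time-reversed adjoint problem:
`inner_curve_duality` extended by density in `k`, then in `l`. -/
theorem Parabolic.duality (h : Parabolic ι T α ω) (k l : Data V H) :
    ⟪(solutionOp ι T k).1 endTime, l.fst⟫ -
        ⟪k.fst, (solutionOp ι (ContinuousLinearMap.adjoint T) l).1 endTime⟫ =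
      ⟪k.snd, timeReverse (solutionOp ι (ContinuousLinearMap.adjoint T) l).2⟫ -
        ⟪(solutionOp ι T k).2, timeReverse l.snd⟫ := by
  have h1 : Continuous fun k : Data V H => k.fst := (WithLp.prod_continuous_ofLp 2 _ _).fst
  have h2 : Continuous fun k : Data V H => k.snd := (WithLp.prod_continuous_ofLp 2 _ _).snd
  have h3 : ∀ T : V →L[ℝ] V, Continuous fun k => (solutionOp ι T k).1 endTime := fun T =>
    (ContinuousMap.evalCLM ℝ endTime).continuous.comp
      (continuous_fst.comp (solutionOp ι T).continuous)
  refine h.denseRange.induction_on (p := fun k =>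
    ⟪(solutionOp ι T k).1 endTime, l.fst⟫ -
        ⟪k.fst, (solutionOp ι (ContinuousLinearMap.adjoint T) l).1 endTime⟫ =
      ⟪k.snd, timeReverse (solutionOp ι (ContinuousLinearMap.adjoint T) l).2⟫ -
        ⟪(solutionOp ι T k).2, timeReverse l.snd⟫) k (isClosed_eq ?_ ?_) fun p => ?_
  · exact ((h3 T).inner continuous_const).sub (h1.inner continuous_const)
  · fun_prop
  refine h.adjoint.denseRange.induction_on (p := fun l =>
    ⟪(solutionOp ι T (dataMap ι T p)).1 endTime, l.fst⟫ -
        ⟪(dataMap ι T p).fst, (solutionOp ι (ContinuousLinearMap.adjoint T) l).1 endTime⟫ =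
      ⟪(dataMap ι T p).snd, timeReverse (solutionOp ι (ContinuousLinearMap.adjoint T) l).2⟫ -
        ⟪(solutionOp ι T (dataMap ι T p)).2, timeReverse l.snd⟫) l (isClosed_eq ?_ ?_) fun q => ?_
  · exact (continuous_const.inner h1).sub (continuous_const.inner (h3 _))
  · fun_prop
  rw [h.solutionOp_dataMap, h.adjoint.solutionOp_dataMap]
  exact inner_curve_duality ι T p q

/-- The difference of the two solutions starts at zero and solves the `T`-equation with forcing `(T'
- T) y'`, where `y'` solves the `T'`-equation. This yields Lipschitz dependence on `ν`. -/
theorem Parabolic.solutionOp_sub {T' : V →L[ℝ] V} (h : Parabolic ι T α ω)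
    (h' : Parabolic ι T' α ω) (k : Data V H) :
    solutionOp ι T k - solutionOp ι T' k =
      solutionOp ι T (WithLp.toLp 2 (0, (T' - T).compLpL 2 timeMeasure (solutionOp ι T' k).2)) := by
  refine h'.denseRange.induction_on (p := fun k => solutionOp ι T k - solutionOp ι T' k =
    solutionOp ι T (WithLp.toLp 2 (0, (T' - T).compLpL 2 timeMeasure (solutionOp ι T' k).2))) k
    (isClosed_eq (by fun_prop) ?_) fun p => ?_
  · refine (solutionOp ι T).continuous.comp ((WithLp.prod_continuous_toLp 2 _ _).comp ?_)
    fun_prop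
  · rw [h'.solutionOp_dataMap, ← h.solutionOp_dataMap, ← map_sub, h.solutionOp_dataMap,
      curveClass_snd, ← contToLp_compCont, dataMap_apply, dataMap_apply, ← WithLp.toLp_sub,
      Prod.mk_sub_mk, sub_self, ← map_sub]
    congr 4
    ext t
    simp [forcing_apply, compCont_apply, curveMap_apply]

theorem Parabolic.adjoint_injective (h : Parabolic ι T α ω) {z : H}
    (hz : ContinuousLinearMap.adjoint ι z = 0) : z = 0 := by
  refine Dense.eq_zero_of_inner_left ℝ h.dense ?_
  rintro _ ⟨v, rfl⟩
  rw [← ContinuousLinearMap.adjoint_inner_left, hz, inner_zero_left]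

/-- The primitive `Y` of `y` is continuous and satisfies `ι* w = -T Y`; integrating once more gives
the hypothesis of `eq_zero_of_gram_eq_integral`. This avoids integration by parts in `W(0,1)`. -/
theorem Parabolic.eq_zero_of_equation (h : Parabolic ι T α ω) {y : ℝ → V} {w : ℝ → H}
    (hy : Integrable y timeMeasure) (hyw : ∀ᵐ t ∂timeMeasure, ι (y t) = w t)
    (he : ∀ t ∈ Icc (0 : ℝ) 1,
      ContinuousLinearMap.adjoint ι (w t) = -∫ s in (0 : ℝ)..t, T (y s)) {t : ℝ}
    (ht : t ∈ Icc (0 : ℝ) 1) : w t = 0 := by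
  set g : ℝ → V := (Ioo (0 : ℝ) 1).indicator y with hg
  have hgy : g =ᵐ[timeMeasure] y := indicator_ae_eq_restrict measurableSet_Ioo
  have hgi : Integrable g := by rwa [hg, integrable_indicator_iff measurableSet_Ioo]
  set Y : ℝ → V := fun t => ∫ s in (0 : ℝ)..t, g s
  have hY : Continuous Y :=
    intervalIntegral.continuous_primitive (fun a b => hgi.intervalIntegrable) (0 : ℝ)
  have he' : ∀ t ∈ Icc (0 : ℝ) 1, ContinuousLinearMap.adjoint ι (w t) = -T (Y t) := by
    intro t ht
    rw [he t ht, ← T.intervalIntegral_comp_comm hgi.intervalIntegrable,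
      ← setIntegral_Ioc_timeMeasure _ ht, ← setIntegral_Ioc_timeMeasure _ ht]
    congr 1
    refine integral_congr_ae (ae_restrict_of_ae ?_)
    filter_upwards [hgy] with s hs
    rw [hs]
  have hM : ∀ t ∈ Icc (0 : ℝ) 1, gram ι (Y t) = -∫ s in (0 : ℝ)..t, T (Y s) := by
    intro t ht
    rw [← ContinuousLinearMap.intervalIntegral_comp_comm _ hgi.intervalIntegrable,
      ← intervalIntegral.integral_neg, ← setIntegral_Ioc_timeMeasure _ ht,
      ← setIntegral_Ioc_timeMeasure _ ht]
    refine integral_congr_ae (ae_restrict_of_ae ?_)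
    filter_upwards [hgy, hyw, ae_timeMeasure_mem] with s h1 h2 h3
    rw [← he' s (Ioo_subset_Icc_self h3), h1, ← h2]
    rfl
  apply h.adjoint_injective
  rw [he' t ht, eq_zero_of_gram_eq_integral h.injective h.α_pos h.ω_nonneg h.garding hY hM ht,
    map_zero, neg_zero]

end Abstract

/-! ### State and adjoint equations in terms of the abstract solution operator. -/

theorem _root_.MeasureTheory.MemLp.intervalIntegrable_timeMeasure {E : Type*} [NormedAddCommGroup E]
    {f : ℝ → E} (hf : MemLp f 2 timeMeasure) {t : ℝ} (ht : t ∈ Icc (0 : ℝ) 1) :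
    IntervalIntegrable f volume 0 t := by
  rw [intervalIntegrable_iff_integrableOn_Ioo_of_le ht.1]
  have h : IntegrableOn f (Ioo 0 1) := hf.integrable one_le_two
  exact h.mono_set (Ioo_subset_Ioo_right ht.2)

/-- The map into `V` that represents, by the Riesz isomorphism, a map into the dual of `V`. -/
def rieszMap {E V : Type*} [NormedAddCommGroup E] [NormedSpace ℝ E]
    [NormedAddCommGroup V] [InnerProductSpace ℝ V] [CompleteSpace V]
    (L : E →L[ℝ] (V →L[ℝ] ℝ)) : E →L[ℝ] V :=
  LinearMap.mkContinuous
    { toFun := fun x => (InnerProductSpace.toDual ℝ V).symm (L x)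
      map_add' := fun x y => by simp
      map_smul' := fun c x => by simp } ‖L‖ fun x => by
    simpa using L.le_opNorm x

theorem inner_rieszMap {E V : Type*} [NormedAddCommGroup E] [NormedSpace ℝ E]
    [NormedAddCommGroup V] [InnerProductSpace ℝ V] [CompleteSpace V]
    (L : E →L[ℝ] (V →L[ℝ] ℝ)) (x : E) (v : V) : ⟪rieszMap L x, v⟫ = L x v :=
  InnerProductSpace.toDual_symm_apply

namespace System

variable {V H Ω : Type*}
  [NormedAddCommGroup V] [InnerProductSpace ℝ V] [CompleteSpace V]
  [NormedAddCommGroup H] [InnerProductSpace ℝ H] [CompleteSpace H]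
  [MeasurableSpace Ω] {ϱ : Measure Ω} (P : System V H Ω ϱ)

theorem toVDual_eq (z : H) : P.toVDual z = innerSL ℝ (ContinuousLinearMap.adjoint P.ι z) := by
  ext v
  rw [toVDual_apply, innerSL_apply_apply, ContinuousLinearMap.adjoint_inner_left]

theorem inW_of_riesz {y g : ℝ → V} {w : ℝ → H} {G : ℝ → V →L[ℝ] ℝ}
    (hG : ∀ t, G t = innerSL ℝ (g t))
    (hy : MemLp y 2 timeMeasure) (hg : MemLp g 2 timeMeasure)
    (hw : ContinuousOn w (Icc 0 1)) (hae : ∀ᵐ t ∂timeMeasure, P.ι (y t) = w t)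
    (heq : ∀ t ∈ Icc (0 : ℝ) 1, ContinuousLinearMap.adjoint P.ι (w t) =
      ContinuousLinearMap.adjoint P.ι (w 0) + ∫ s in (0 : ℝ)..t, g s) :
    P.InW y G w := by
  obtain rfl : G = fun t => innerSL ℝ (g t) := funext hG
  refine ⟨hy, (innerSL ℝ : V →L[ℝ] V →L[ℝ] ℝ).comp_memLp' hg, hw, hae, fun t ht => ?_⟩
  have := (innerSL ℝ : V →L[ℝ] V →L[ℝ] ℝ).intervalIntegral_comp_comm
    (hg.intervalIntegrable_timeMeasure ht)
  rw [toVDual_eq, toVDual_eq, heq t ht, map_add, this]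

theorem InW.riesz_equation {P : System V H Ω ϱ} {y g : ℝ → V} {w : ℝ → H} {G : ℝ → V →L[ℝ] ℝ}
    (h : P.InW y G w) (hG : ∀ t, G t = innerSL ℝ (g t)) (hg : MemLp g 2 timeMeasure) {t : ℝ}
    (ht : t ∈ Icc (0 : ℝ) 1) : ContinuousLinearMap.adjoint P.ι (w t) =
      ContinuousLinearMap.adjoint P.ι (w 0) + ∫ s in (0 : ℝ)..t, g s := by
  obtain rfl : G = fun t => innerSL ℝ (g t) := funext hG
  have := (innerSL ℝ : V →L[ℝ] V →L[ℝ] ℝ).intervalIntegral_comp_comm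
    (hg.intervalIntegrable_timeMeasure ht)
  have h2 := h.eq_integral t ht
  rw [this, toVDual_eq, toVDual_eq, ← map_add] at h2
  refine ext_inner_right ℝ fun v => ?_
  rw [← innerSL_apply_apply ℝ, h2, innerSL_apply_apply]

/-- The operator on `V` that represents the form `ν a`. -/
def operator (ν : ℝ) : V →L[ℝ] V := ν • rieszMap P.a

/-- The operator on controls that represents `B` pointwise in time. -/
def controlOp : Control ϱ →L[ℝ] Lp V 2 timeMeasure := (rieszMap P.B).compLpL 2 timeMeasure

/-- The data of the state equation. -/
def stateData (ν : ℝ) (u : Control ϱ) : Data V H := WithLp.toLp 2 (P.y0, ν • P.controlOp u)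

theorem exists_parabolic {νmin : ℝ} (hν : 0 < νmin) (νmax : ℝ) (h : νmin ≤ νmax) :
    ∃ α ω, ∀ ν ∈ Icc νmin νmax, Parabolic P.ι (P.operator ν) α ω := by
  obtain ⟨α₀, hα₀, ω₀, hω₀, hG⟩ := P.garding
  -- Constants valid for the whole parameter interval, so that `solutionBound` is uniform in `ν`.
  refine ⟨νmin * α₀, νmax * ω₀, fun ν hν' => ⟨P.ι_injective, P.ι_dense, by positivity,
    mul_nonneg (hν.le.trans h) hω₀, fun v => ?_⟩⟩
  have hν0 : 0 < ν := hν.trans_le hν'.1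
  have h1 := mul_le_mul_of_nonneg_left (hG v) hν0.le
  have h2 : ⟪P.operator ν v, v⟫ = ν * P.a v v := by
    simp [operator, inner_smul_left, inner_rieszMap]
  have h3 : 0 ≤ (ν - νmin) * (α₀ * ‖v‖ ^ 2) := mul_nonneg (sub_nonneg.2 hν'.1) (by positivity)
  have h4 : 0 ≤ (νmax - ν) * (ω₀ * ‖P.ι v‖ ^ 2) := mul_nonneg (sub_nonneg.2 hν'.2) (by positivity)
  rw [h2]
  nlinarith

theorem state_rhs_eq (ν : ℝ) (q : Lp ℝ 2 ϱ) (v : V) :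
    ν • (P.B q - P.a v) = innerSL ℝ (ν • (rieszMap P.B q - rieszMap P.a v)) := by
  ext z
  simp [inner_rieszMap]

theorem memLp_state_rhs (ν : ℝ) (u : Control ϱ) {y : ℝ → V} (hy : MemLp y 2 timeMeasure) :
    MemLp (fun t => ν • (rieszMap P.B (u t) - rieszMap P.a (y t))) 2 timeMeasure :=
  (((rieszMap P.B).comp_memLp' (Lp.memLp u)).sub ((rieszMap P.a).comp_memLp' hy)).const_smul ν

variable {P} {ν α ω : ℝ}

theorem isState_solutionOp (h : Parabolic P.ι (P.operator ν) α ω) (u : Control ϱ) :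
    P.IsState ν u (solutionOp P.ι (P.operator ν) (P.stateData ν u)).2
      (IccExtend zero_le_one (solutionOp P.ι (P.operator ν) (P.stateData ν u)).1) := by
  set k := P.stateData ν u with hk
  set S := solutionOp P.ι (P.operator ν) k
  have h0 : IccExtend zero_le_one S.1 0 = P.y0 := by
    rw [IccExtend_of_mem _ _ (left_mem_Icc.2 zero_le_one)]
    exact h.solutionOp_zero k
  refine ⟨P.inW_of_riesz (fun t => P.state_rhs_eq ν (u t) (S.2 t)) (Lp.memLp _)
    (P.memLp_state_rhs ν u (Lp.memLp _)) S.1.continuous.Icc_extend'.continuousOn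
    (h.solutionOp_ae_eq k) fun t ht => ?_, h0⟩
  rw [h0, IccExtend_of_mem _ _ ht]
  refine h.solutionOp_equation k ?_ ⟨t, ht⟩
  have hks : k.snd = ν • P.controlOp u := rfl
  filter_upwards [Lp.coeFn_smul ν (P.controlOp u), (rieszMap P.B).coeFn_compLpL u] with t h1 h2
  rw [hks, h1, Pi.smul_apply, controlOp, h2, operator, smul_apply, smul_sub]
  rfl

theorem IsState.final_unique (h : Parabolic P.ι (P.operator ν) α ω) {u : Control ϱ}
    {y y' : ℝ → V} {w w' : ℝ → H} (hy : P.IsState ν u y w) (hy' : P.IsState ν u y' w') :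
    w 1 = w' 1 := by
  refine sub_eq_zero.1 (h.eq_zero_of_equation (y := fun t => y t - y' t)
    (w := fun t => w t - w' t) ((hy.1.memLp.sub hy'.1.memLp).integrable one_le_two) ?_
    (fun t ht => ?_) (right_mem_Icc.2 zero_le_one))
  · filter_upwards [hy.1.ae_eq, hy'.1.ae_eq] with t h1 h2
    rw [map_sub, h1, h2]
  · have m1 := P.memLp_state_rhs ν u hy.1.memLp
    have m2 := P.memLp_state_rhs ν u hy'.1.memLp
    rw [map_sub, hy.1.riesz_equation (fun t => P.state_rhs_eq ν (u t) (y t)) m1 ht,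
      hy'.1.riesz_equation (fun t => P.state_rhs_eq ν (u t) (y' t)) m2 ht, hy.2, hy'.2,
      add_sub_add_left_eq_sub, ← intervalIntegral.integral_sub
        (m1.intervalIntegrable_timeMeasure ht) (m2.intervalIntegrable_timeMeasure ht),
      ← intervalIntegral.integral_neg]
    congr 1
    ext s
    simp only [operator, smul_apply, map_sub, smul_sub]
    abel

/-- Existence makes the choice in `finalState` meaningful, and uniqueness identifies the chosen
value. -/
theorem finalState_eq (h : Parabolic P.ι (P.operator ν) α ω) (u : Control ϱ) :
    P.finalState ν u = (solutionOp P.ι (P.operator ν) (P.stateData ν u)).1 endTime := by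
  have hs := isState_solutionOp h u
  have hex : ∃ z, ∃ y w, P.IsState ν u y w ∧ w 1 = z := ⟨_, _, _, hs, rfl⟩
  obtain ⟨y, w, hyw, hw⟩ := Classical.epsilon_spec hex
  change Classical.epsilon _ = _
  rw [← hw, hyw.final_unique h hs, IccExtend_of_mem _ _ (right_mem_Icc.2 zero_le_one)]
  rfl

variable (P) in
/-- The dependence of the final state on the control, without the affine part. -/
def finalOp (ν : ℝ) : Control ϱ →L[ℝ] H :=
  (ContinuousMap.evalCLM ℝ endTime) ∘L ContinuousLinearMap.fst ℝ _ _ ∘L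
    solutionOp P.ι (P.operator ν) ∘L
    (WithLp.prodContinuousLinearEquiv 2 ℝ H (Lp V 2 timeMeasure)).symm.toContinuousLinearMap ∘L
    ContinuousLinearMap.inr ℝ _ _ ∘L (ν • P.controlOp)

theorem finalOp_apply (u : Control ϱ) : P.finalOp ν u =
    (solutionOp P.ι (P.operator ν) (WithLp.toLp 2 (0, ν • P.controlOp u))).1 endTime := rfl

theorem finalState_sub (h : Parabolic P.ι (P.operator ν) α ω) (u u' : Control ϱ) :
    P.finalState ν u - P.finalState ν u' = P.finalOp ν (u - u') := by
  rw [finalState_eq h, finalState_eq h, finalOp_apply, ← ContinuousMap.sub_apply, ← Prod.fst_sub,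
    ← map_sub, stateData, stateData, ← WithLp.toLp_sub, Prod.mk_sub_mk, sub_self, ← smul_sub,
    map_sub]

variable (P) in
/-- The solution in `L²(I; V)` of the backward equation `-∂ₜ p + ν A* p = 0`, `p(1) = e`. -/
def backwardState (ν : ℝ) (e : H) : Lp V 2 timeMeasure :=
  timeReverse (solutionOp P.ι (ContinuousLinearMap.adjoint (P.operator ν))
    (WithLp.toLp 2 (e, 0))).2

theorem backward_rhs_eq (ν : ℝ) (v : V) :
    ν • P.a.flip v = innerSL ℝ (ContinuousLinearMap.adjoint (P.operator ν) v) := by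
  ext z
  simp [operator, ContinuousLinearMap.adjoint_inner_left,
    real_inner_comm _ v, inner_rieszMap]

theorem exists_inW_backwardState (h : Parabolic P.ι (P.operator ν) α ω) (e : H) :
    ∃ w : ℝ → H, P.InW (P.backwardState ν e)
      (fun t => ν • P.a.flip (P.backwardState ν e t)) w ∧ w 1 = e := by
  set k : Data V H := WithLp.toLp 2 (e, 0)
  set A := ContinuousLinearMap.adjoint (P.operator ν) with hA
  set S := solutionOp P.ι A k with hS
  have hp : P.backwardState ν e =ᵐ[timeMeasure] fun t => S.2 (1 - t) := coeFn_timeReverse S.2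
  have hmem : MemLp (fun t => A (P.backwardState ν e t)) 2 timeMeasure :=
    A.comp_memLp' (Lp.memLp (P.backwardState ν e))
  have heq := h.adjoint.solutionOp_equation k (g := fun s => -A (P.backwardState ν e (1 - s))) (by
    have hp' := measurePreserving_one_sub.quasiMeasurePreserving.ae hp
    filter_upwards [hp', Lp.coeFn_zero V 2 timeMeasure] with t h1 h2
    have : k.snd = 0 := rfl
    rw [this, h2, h1]
    simp [← hA, ← hS])
  refine ⟨fun t => IccExtend zero_le_one S.1 (1 - t), P.inW_of_riesz
    (fun t => backward_rhs_eq ν (P.backwardState ν e t)) (Lp.memLp _) hmem ?_ ?_ ?_, ?_⟩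
  · exact (S.1.continuous.Icc_extend'.comp (by fun_prop : Continuous fun t : ℝ => 1 - t)).continuousOn
  · filter_upwards [hp, measurePreserving_one_sub.quasiMeasurePreserving.ae
      (h.adjoint.solutionOp_ae_eq k)] with t h1 h2
    rw [h1]; exact h2
  · intro t ht
    have ht' : 1 - t ∈ Icc (0 : ℝ) 1 := ⟨by linarith [ht.2], by linarith [ht.1]⟩
    -- Comparing the reversed equation at `1 - t` and at `1` leaves exactly the integral over `(0,
    -- t)`.
    have h1 := heq ⟨1 - t, ht'⟩
    have h2 := heq ⟨1, right_mem_Icc.2 zero_le_one⟩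
    rw [sub_zero, IccExtend_of_mem _ _ ht', IccExtend_of_mem _ _ (right_mem_Icc.2 zero_le_one)]
    rw [h1, h2, add_assoc]
    congr 1
    simp only [intervalIntegral.integral_neg]
    rw [intervalIntegral.integral_comp_sub_left (fun s => A (P.backwardState ν e s)) 1,
      intervalIntegral.integral_comp_sub_left (fun s => A (P.backwardState ν e s)) 1]
    have i1 := hmem.intervalIntegrable_timeMeasure (t := 1) (right_mem_Icc.2 zero_le_one)
    have i2 := hmem.intervalIntegrable_timeMeasure ht
    have := intervalIntegral.integral_add_adjacent_intervals i2 (i2.symm.trans i1)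
    simp only [sub_sub_cancel, sub_zero, sub_self]
    rw [← this]
    abel
  · change IccExtend zero_le_one S.1 (1 - 1) = e
    rw [sub_self, IccExtend_of_mem _ _ (left_mem_Icc.2 zero_le_one)]
    exact h.adjoint.solutionOp_zero k

/-- Duality for the data `(0, ν B u)` and `(e, 0)`, where two of the four terms vanish. -/
theorem inner_finalOp (h : Parabolic P.ι (P.operator ν) α ω) (u : Control ϱ) (e : H) :
    ⟪P.finalOp ν u, e⟫ = ν * ⟪P.controlOp u, P.backwardState ν e⟫ := by
  have := h.duality (WithLp.toLp 2 (0, ν • P.controlOp u)) (WithLp.toLp 2 (e, 0))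
  simp only [WithLp.toLp_fst, WithLp.toLp_snd, map_zero, inner_zero_left, inner_zero_right,
    sub_zero, inner_smul_left] at this
  exact this

theorem inner_controlOp (u : Control ϱ) (p : Lp V 2 timeMeasure) :
    ⟪P.controlOp u, p⟫ = ∫ t, ⟪P.Badj (p t), u t⟫ ∂timeMeasure := by
  rw [L2.inner_def]
  refine integral_congr_ae ?_
  filter_upwards [(rieszMap P.B).coeFn_compLpL u] with t ht
  rw [controlOp, ht, inner_rieszMap, inner_Badj]

end System

/-! ### Hölder and interpolation inequalities for the mixed norms. -/

section Norms

variable {Ω : Type*} [MeasurableSpace Ω] {ϱ : Measure Ω}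

theorem enorm_sq_eq_lintegral {α E : Type*} [MeasurableSpace α] {μ : Measure α}
    [NormedAddCommGroup E] (f : Lp E 2 μ) : ‖f‖ₑ ^ 2 = ∫⁻ x, ‖f x‖ₑ ^ 2 ∂μ := by
  have := eLpNorm_nnreal_pow_eq_lintegral (f := f) (μ := μ) (p := 2) two_ne_zero
  rw [Lp.enorm_def]
  simpa using this

theorem enorm_inner_le (q h : Lp ℝ 2 ϱ) : ‖⟪q, h⟫‖ₑ ≤ eLpNorm q ∞ ϱ * eLpNorm h 1 ϱ := by
  rw [L2.inner_def, eLpNorm_exponent_top, eLpNorm_one_eq_lintegral_enorm,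
    ← lintegral_const_mul'' _ (Lp.aestronglyMeasurable h).enorm]
  refine (enorm_integral_le_lintegral_enorm _).trans (lintegral_mono_ae ?_)
  filter_upwards [enorm_ae_le_eLpNormEssSup q ϱ] with x hx
  rw [RCLike.inner_apply, conj_trivial, enorm_mul, mul_comm]
  gcongr

theorem ofReal_integral_inner_le {q h : ℝ → Lp ℝ 2 ϱ} {r : ℝ≥0∞} (hr : r ≠ ∞)
    (hq : normLInf q ≤ r) :
    ENNReal.ofReal (∫ t, ⟪q t, h t⟫ ∂timeMeasure) ≤ r * normL1 h := by
  have h1 : ENNReal.ofReal (∫ t, ⟪q t, h t⟫ ∂timeMeasure) ≤ ‖∫ t, ⟪q t, h t⟫ ∂timeMeasure‖ₑ := by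
    rw [← ofReal_norm]
    exact ENNReal.ofReal_le_ofReal (le_abs_self _)
  refine h1.trans ((enorm_integral_le_lintegral_enorm _).trans ?_)
  rw [normL1, ← lintegral_const_mul' _ _ hr]
  refine lintegral_mono_ae ?_
  filter_upwards [ae_le_essSup (f := fun t => eLpNorm (q t) ∞ ϱ) (μ := timeMeasure)] with t ht
  refine (enorm_inner_le _ _).trans ?_
  gcongr
  exact ht.trans hq

/-- Interpolation of `L²` between `L¹` and `L^∞`; it turns the growth in `L¹` into boundedness in
`L²`. -/
theorem enorm_sq_le_mul_normL1 {h : Control ϱ} {M : ℝ}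
    (hM : ∀ᵐ t ∂timeMeasure, ∀ᵐ x ∂ϱ, |h t x| ≤ M) :
    ‖h‖ₑ ^ 2 ≤ ENNReal.ofReal M * normL1 h := by
  rw [enorm_sq_eq_lintegral, normL1, ← lintegral_const_mul' _ _ ENNReal.ofReal_ne_top]
  refine lintegral_mono_ae ?_
  filter_upwards [hM] with t ht
  rw [enorm_sq_eq_lintegral, eLpNorm_one_eq_lintegral_enorm,
    ← lintegral_const_mul' _ _ ENNReal.ofReal_ne_top]
  refine lintegral_mono_ae ?_
  filter_upwards [ht] with x hx
  rw [sq]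
  gcongr
  rw [← ofReal_norm]
  exact ENNReal.ofReal_le_ofReal hx

end Norms

/-! ### First-order conditions for the distance function. -/

section Convexity

variable {H : Type*} [NormedAddCommGroup H] [InnerProductSpace ℝ H]

/-- Expand the square, divide by `s` and let `s → 0`; working with squares also covers `a = 0`. -/
theorem inner_nonneg_of_norm_le_add_smul {a b : H}
    (h : ∀ s ∈ Ioc (0 : ℝ) 1, ‖a‖ ≤ ‖a + s • b‖) : 0 ≤ ⟪b, a⟫ := by
  have key : ∀ s ∈ Ioc (0 : ℝ) 1, 0 ≤ 2 * ⟪b, a⟫ + s * ‖b‖ ^ 2 := by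
    intro s hs
    have h1 : ‖a‖ ^ 2 ≤ ‖a + s • b‖ ^ 2 := by gcongr; exact h s hs
    rw [norm_add_sq_real, norm_smul, inner_smul_right, real_inner_comm, mul_pow,
      Real.norm_eq_abs, sq_abs] at h1
    have h2 : 0 ≤ s * (2 * ⟪b, a⟫ + s * ‖b‖ ^ 2) := by nlinarith
    exact nonneg_of_mul_nonneg_right h2 hs.1
  have ht : Filter.Tendsto (fun s : ℝ => 2 * ⟪b, a⟫ + s * ‖b‖ ^ 2) (nhdsWithin 0 (Ioi 0))
      (nhds (2 * ⟪b, a⟫)) := by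
    refine Filter.Tendsto.mono_left ?_ nhdsWithin_le_nhds
    have : Continuous fun s : ℝ => 2 * ⟪b, a⟫ + s * ‖b‖ ^ 2 := by fun_prop
    simpa using this.tendsto 0
  have := ge_of_tendsto ht (by
    filter_upwards [Ioc_mem_nhdsGT (zero_lt_one (α := ℝ))] with s hs using key s hs)
  linarith

/-- The derivative of a distance function is bounded by the subgradient at the other end. -/
theorem fderiv_le_inner_of_norm {U : Type*} [NormedAddCommGroup U] [NormedSpace ℝ U]
    {φ : U → ℝ} {L : U →L[ℝ] H} {b : H} {c : ℝ} {u₀ : U}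
    (hφ : ∀ u, φ u = ‖b + L (u - u₀)‖ - c) (hd : DifferentiableAt ℝ φ u₀) (u : U)
    (ha : b + L (u - u₀) ≠ 0) :
    fderiv ℝ φ u₀ (u - u₀) ≤
      ⟪L (u - u₀), ‖b + L (u - u₀)‖⁻¹ • (b + L (u - u₀))⟫ := by
  set h := u - u₀ with hh
  set a := b + L h with ha'
  have h1 : HasDerivAt (fun s : ℝ => φ (u₀ + s • h)) (fderiv ℝ φ u₀ h) 0 := by
    have hl : HasDerivAt (fun s : ℝ => u₀ + s • h) h 0 := by
      simpa using ((hasDerivAt_id (0 : ℝ)).smul_const h).const_add u₀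
    have hd' : HasFDerivAt φ (fderiv ℝ φ u₀) (u₀ + (0 : ℝ) • h) := by simpa using hd.hasFDerivAt
    exact hd'.comp_hasDerivAt 0 hl
  -- By convexity, every difference quotient with step in `(0, 1]` is at most the one with step `1`.
  have h2 : fderiv ℝ φ u₀ h ≤ ‖a‖ - ‖b‖ := by
    have ht := (hasDerivAt_iff_tendsto_slope.1 h1).mono_left
      (nhdsWithin_mono 0 (show Ioi (0 : ℝ) ⊆ {0}ᶜ from fun s hs => ne_of_gt hs))
    refine le_of_tendsto ht ?_
    filter_upwards [Ioc_mem_nhdsGT (zero_lt_one (α := ℝ))] with s hs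
    rw [slope_def_field, sub_zero, div_le_iff₀ hs.1, hφ, hφ]
    have e : b + L (u₀ + s • h - u₀) = (1 - s) • b + s • a := by
      rw [add_sub_cancel_left, map_smul, ha', smul_add, sub_smul, one_smul]; abel
    have h3 : ‖(1 - s) • b + s • a‖ ≤ (1 - s) * ‖b‖ + s * ‖a‖ := by
      refine (norm_add_le _ _).trans_eq ?_
      rw [norm_smul, norm_smul, Real.norm_of_nonneg (sub_nonneg.2 hs.2),
        Real.norm_of_nonneg hs.1.le]
    rw [e]
    simp only [zero_smul, add_zero, sub_self, map_zero]
    nlinarith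
  refine h2.trans ?_
  have hna : 0 < ‖a‖ := norm_pos_iff.2 ha
  have e : L h = a - b := by rw [ha', add_sub_cancel_left]
  rw [e, inner_smul_right, inner_sub_left, real_inner_self_eq_norm_sq]
  have h4 : ‖a‖⁻¹ * ⟪b, a⟫ ≤ ‖b‖ := by
    rw [inv_mul_le_iff₀ hna, mul_comm]
    exact real_inner_le_norm b a
  have h5 : ‖a‖⁻¹ * ‖a‖ ^ 2 = ‖a‖ := by field_simp
  rw [mul_sub, h5]
  linarith

end Convexity

/-! ### Admissible controls, dependence on `ν`, and the stability estimate. -/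

namespace System

variable {V H Ω : Type*}
  [NormedAddCommGroup V] [InnerProductSpace ℝ V] [CompleteSpace V]
  [NormedAddCommGroup H] [InnerProductSpace ℝ H] [CompleteSpace H]
  [MeasurableSpace Ω] {ϱ : Measure Ω} {P : System V H Ω ϱ}

theorem add_smul_sub_mem_Uad {u u' : Control ϱ} (hu : u ∈ P.Uad) (hu' : u' ∈ P.Uad) {s : ℝ}
    (hs : s ∈ Icc (0 : ℝ) 1) : u + s • (u' - u) ∈ P.Uad := by
  change ∀ᵐ t ∂timeMeasure, _
  filter_upwards [hu, hu', Lp.coeFn_add u (s • (u' - u)), Lp.coeFn_smul s (u' - u),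
    Lp.coeFn_sub u' u] with t h1 h2 h3 h4 h5
  rw [h3, Pi.add_apply, h4, Pi.smul_apply, h5, Pi.sub_apply]
  filter_upwards [h1, h2, Lp.coeFn_add (u t) (s • (u' t - u t)), Lp.coeFn_smul s (u' t - u t),
    Lp.coeFn_sub (u' t) (u t)] with x g1 g2 g3 g4 g5
  rw [g3, Pi.add_apply, g4, Pi.smul_apply, g5, Pi.sub_apply, smul_eq_mul]
  obtain ⟨hs0, hs1⟩ := hs
  constructor <;> nlinarith

theorem abs_sub_le_of_mem_Uad {u u' : Control ϱ} (hu : u ∈ P.Uad) (hu' : u' ∈ P.Uad) :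
    ∀ᵐ t ∂timeMeasure, ∀ᵐ x ∂ϱ, |(u' - u : Control ϱ) t x| ≤ ‖P.ua‖ + ‖P.ub‖ := by
  have hb : ∀ f : Lp ℝ ∞ ϱ, ∀ᵐ x ∂ϱ, |f x| ≤ ‖f‖ := fun f => by
    filter_upwards [ae_le_eLpNormEssSup (f := f) (μ := ϱ)] with x hx
    rw [Lp.norm_def, eLpNorm_exponent_top, ← Real.norm_eq_abs, ← toReal_enorm]
    refine ENNReal.toReal_mono ?_ hx
    have := Lp.eLpNorm_ne_top f
    rwa [eLpNorm_exponent_top] at this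
  filter_upwards [hu, hu', Lp.coeFn_sub u' u] with t h1 h2 h5
  rw [h5, Pi.sub_apply]
  filter_upwards [h1, h2, Lp.coeFn_sub (u' t) (u t), hb P.ua, hb P.ub] with x g1 g2 g5 g6 g7
  rw [g5, Pi.sub_apply]
  rw [abs_le] at g6 g7 ⊢
  constructor <;> linarith [g6.1, g6.2, g7.1, g7.2, g1.1, g1.2, g2.1, g2.2]

theorem norm_data_snd (f : Lp V 2 timeMeasure) : ‖(WithLp.toLp 2 (0, f) : Data V H)‖ = ‖f‖ := by
  rw [← sq_eq_sq₀ (norm_nonneg _) (norm_nonneg _), WithLp.prod_norm_sq_eq_of_L2]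
  simp

-- Changing `ν` changes the forcing by `(ν - ν') B u` and the operator by `(ν' - ν) A`; by
-- `solutionOp_sub` both enter as forcings, estimated with the uniform `solutionBound`.
variable (P) in
theorem exists_norm_finalState_sub_le {νmin νmax α ω : ℝ}
    (hP : ∀ ν ∈ Icc νmin νmax, Parabolic P.ι (P.operator ν) α ω) (R : ℝ) :
    ∃ C, 0 ≤ C ∧ ∀ ν ∈ Icc νmin νmax, ∀ ν' ∈ Icc νmin νmax, ∀ u : Control ϱ, ‖u‖ ≤ R →
      ‖P.finalState ν u - P.finalState ν' u‖ ≤ C * |ν - ν'| := by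
  rcases lt_or_ge R 0 with hR | hR
  · exact ⟨0, le_rfl, fun _ _ _ _ u hu => absurd (hu.trans_lt hR) (norm_nonneg u).not_gt⟩
  rcases lt_or_ge νmax νmin with hν | hν
  · exact ⟨0, le_rfl, fun ν h => absurd (h.1.trans h.2) hν.not_ge⟩
  set c := solutionBound α ω with hc
  have hc0 : 0 ≤ c := (hP νmin (left_mem_Icc.2 hν)).solutionBound_nonneg
  set K := ‖P.controlOp‖ * R with hK
  have hK0 : 0 ≤ K := by positivity
  set N := ‖P.y0‖ + (|νmin| + |νmax|) * K with hN
  refine ⟨c * K + c * (‖rieszMap P.a‖ * (c * N)), by positivity, fun ν hν ν' hν' u hu => ?_⟩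
  have h := hP ν hν
  have h' := hP ν' hν'
  have hKu : ‖P.controlOp u‖ ≤ K := (P.controlOp.le_opNorm u).trans (mul_le_mul_of_nonneg_left hu (norm_nonneg _))
  have hN' : ‖P.stateData ν' u‖ ≤ N := by
    have e : P.stateData ν' u = (WithLp.toLp 2 (P.y0, 0) : Data V H) +
        WithLp.toLp 2 (0, ν' • P.controlOp u) := by
      rw [← WithLp.toLp_add, Prod.mk_add_mk, add_zero, zero_add]; rfl
    have e1 : ‖(WithLp.toLp 2 (P.y0, 0) : Data V H)‖ = ‖P.y0‖ := by
      rw [← sq_eq_sq₀ (norm_nonneg _) (norm_nonneg _), WithLp.prod_norm_sq_eq_of_L2]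
      simp
    rw [e]
    refine (norm_add_le _ _).trans ?_
    rw [e1, norm_data_snd, norm_smul, Real.norm_eq_abs]
    have : |ν'| ≤ |νmin| + |νmax| := by
      rw [abs_le]
      constructor
      · linarith [neg_abs_le νmin, abs_nonneg νmax, hν'.1]
      · linarith [le_abs_self νmax, abs_nonneg νmin, hν'.2]
    rw [hN]
    gcongr
  set S := solutionOp P.ι (P.operator ν) with hS
  set S' := solutionOp P.ι (P.operator ν') with hS'
  have e0 : S (P.stateData ν u) - S' (P.stateData ν' u) =
      S (WithLp.toLp 2 (0, (ν - ν') • P.controlOp u)) +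
        S (WithLp.toLp 2 (0, (P.operator ν' - P.operator ν).compLpL 2 timeMeasure
          (S' (P.stateData ν' u)).2)) := by
    rw [← h.solutionOp_sub h', ← sub_add_sub_cancel _ (S (P.stateData ν' u)), ← map_sub]
    congr 2
    rw [stateData, stateData, ← WithLp.toLp_sub, Prod.mk_sub_mk, sub_self, ← sub_smul]
  have b1 : ‖S (WithLp.toLp 2 (0, (ν - ν') • P.controlOp u))‖ ≤ c * (|ν - ν'| * K) := by
    refine (h.norm_solutionOp_apply_le _).trans ?_
    rw [norm_data_snd, norm_smul, Real.norm_eq_abs]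
    gcongr
  have b2 : ‖S (WithLp.toLp 2 (0, (P.operator ν' - P.operator ν).compLpL 2 timeMeasure
      (S' (P.stateData ν' u)).2))‖ ≤ c * ((|ν - ν'| * ‖rieszMap P.a‖) * (c * N)) := by
    refine (h.norm_solutionOp_apply_le _).trans ?_
    rw [norm_data_snd]
    have o1 : ‖P.operator ν' - P.operator ν‖ = |ν - ν'| * ‖rieszMap P.a‖ := by
      rw [operator, operator, ← sub_smul, norm_smul, Real.norm_eq_abs, abs_sub_comm]
    have o2 : ‖(S' (P.stateData ν' u)).2‖ ≤ c * N := by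
      refine (norm_snd_le _).trans ((h'.norm_solutionOp_apply_le _).trans ?_)
      gcongr
    have o3 := (ContinuousLinearMap.norm_compLp_le (P.operator ν' - P.operator ν)
      (S' (P.stateData ν' u)).2)
    rw [o1] at o3
    refine mul_le_mul_of_nonneg_left (o3.trans ?_) hc0
    gcongr
  have e2 : P.finalState ν u - P.finalState ν' u =
      (S (P.stateData ν u) - S' (P.stateData ν' u)).1 endTime := by
    rw [finalState_eq h, finalState_eq h']; rfl
  rw [e2]
  calc _ ≤ ‖S (P.stateData ν u) - S' (P.stateData ν' u)‖ :=
        (ContinuousMap.norm_coe_le_norm _ _).trans (norm_fst_le _)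
    _ ≤ c * (|ν - ν'| * K) + c * ((|ν - ν'| * ‖rieszMap P.a‖) * (c * N)) := by
        rw [e0]; exact (norm_add_le _ _).trans (add_le_add b1 b2)
    _ = _ := by ring

variable {ν α ω : ℝ}

/-- Variational inequality at an optimal control: `Uad` is convex and the final state is affine in
the control. -/
theorem inner_finalOp_nonneg (h : Parabolic P.ι (P.operator ν) α ω) {u u' : Control ϱ}
    (hu : u ∈ P.optControls ν) (hu' : u' ∈ P.Uad) :
    0 ≤ ⟪P.finalOp ν (u' - u), P.finalState ν u - P.yd⟫ := by
  refine inner_nonneg_of_norm_le_add_smul fun s hs => ?_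
  have h1 := hu.2 _ (add_smul_sub_mem_Uad hu.1 hu' (Ioc_subset_Icc_self hs))
  have h2 := finalState_sub h (u + s • (u' - u)) u
  rw [add_sub_cancel_left, map_smul] at h2
  rw [← h2]
  convert h1 using 2
  abel

/-- The derivative of `f(ν, ·)` in the direction of a control `u` is bounded by the pairing with
the adjoint state at `u`. -/
theorem fderiv_f_le (h : Parabolic P.ι (P.operator ν) α ω) {u₀ u : Control ϱ}
    (hd : DifferentiableAt ℝ (P.f ν) u₀) (hu : P.finalState ν u ≠ P.yd) :
    fderiv ℝ (P.f ν) u₀ (u - u₀) ≤ ν * ⟪P.controlOp (u - u₀), P.backwardState ν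
      (‖P.finalState ν u - P.yd‖⁻¹ • (P.finalState ν u - P.yd))⟫ := by
  have e : ∀ u, P.finalState ν u₀ - P.yd + P.finalOp ν (u - u₀) = P.finalState ν u - P.yd :=
    fun u => by rw [← finalState_sub h]; abel
  have := fderiv_le_inner_of_norm (φ := P.f ν) (L := P.finalOp ν)
    (b := P.finalState ν u₀ - P.yd) (c := P.δ₀) (u₀ := u₀) (fun u => by rw [e]; rfl) hd u
    (by rw [e]; exact sub_ne_zero.2 hu)
  rwa [e, inner_finalOp h] at this

theorem isAdjointState_backwardState (h : Parabolic P.ι (P.operator ν) α ω) {u : Control ϱ}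
    (hu : P.finalState ν u ≠ P.yd) :
    P.IsAdjointState ν u (P.backwardState ν
      (‖P.finalState ν u - P.yd‖⁻¹ • (P.finalState ν u - P.yd))) :=
  ⟨hu, exists_inW_backwardState h _⟩

/-- The growth condition bounds the square of this norm by a derivative, which is a finite number.
-/
theorem GrowthCondition.normL1_ne_top {c₀ : ℝ} {u₀ : Control ϱ} (hg : P.GrowthCondition ν u₀ c₀)
    (hc : 0 < ν * c₀) {u : Control ϱ} (hu : u ∈ P.Uad) : normL1 ⇑(u - u₀) ≠ ∞ := by
  intro htop
  have := hg.2 u hu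
  rw [htop, ENNReal.top_pow two_ne_zero,
    ENNReal.mul_top (by simpa using hc)] at this
  exact ENNReal.ofReal_ne_top (top_le_iff.1 this)

/-- The growth condition makes the set of admissible controls bounded. -/
theorem GrowthCondition.exists_norm_le {c₀ : ℝ} {u₀ : Control ϱ} (hg : P.GrowthCondition ν u₀ c₀)
    (hc : 0 < ν * c₀) (hu₀ : u₀ ∈ P.Uad) : ∃ R, ∀ u ∈ P.Uad, ‖u‖ ≤ R := by
  set D := ‖fderiv ℝ (P.f ν) u₀‖ with hD
  set M := ‖P.ua‖ + ‖P.ub‖ with hM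
  have hM0 : 0 ≤ M := by positivity
  set K := M ^ 2 * D / (ν * c₀) with hK
  have hK0 : 0 ≤ K := by positivity
  refine ⟨‖u₀‖ + (1 + K), fun u hu => ?_⟩
  set h := u - u₀ with hh
  have hfin := hg.normL1_ne_top hc hu
  have h1 := enorm_sq_le_mul_normL1 (abs_sub_le_of_mem_Uad hu₀ hu)
  have h2 := hg.2 u hu
  obtain ⟨n, hn0, hn⟩ : ∃ n : ℝ, 0 ≤ n ∧ normL1 ⇑(u - u₀) = ENNReal.ofReal n :=
    ⟨_, ENNReal.toReal_nonneg, (ENNReal.ofReal_toReal hfin).symm⟩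
  rw [hn, ← ENNReal.ofReal_mul hM0, ← ofReal_norm, ← ENNReal.ofReal_pow (norm_nonneg _),
    ENNReal.ofReal_le_ofReal_iff (by positivity)] at h1
  have h3 : fderiv ℝ (P.f ν) u₀ (u - u₀) ≤ D * ‖h‖ :=
    (le_abs_self _).trans ((fderiv ℝ (P.f ν) u₀).le_opNorm _)
  have h4 := h2.trans (ENNReal.ofReal_le_ofReal h3)
  rw [hn, ← ENNReal.ofReal_pow hn0, ← ENNReal.ofReal_mul hc.le,
    ENNReal.ofReal_le_ofReal_iff (by positivity)] at h4
  -- Combining `‖h‖² ≤ M n` with `ν c₀ n² ≤ D ‖h‖` gives `‖h‖³ ≤ K`; assuming `‖h‖ > 1` allows `‖h‖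
  -- ≤ ‖h‖³` instead of a cube root.
  have h5 : ‖h‖ ≤ 1 + K := by
    by_contra! hlt
    have hx1 : 1 ≤ ‖h‖ := by linarith
    have hx0 : 0 < ‖h‖ := by linarith
    have e1 : (‖h‖ ^ 2) ^ 2 ≤ (M * n) ^ 2 := by gcongr
    have e2 : ν * c₀ * (‖h‖ ^ 2) ^ 2 ≤ M ^ 2 * D * ‖h‖ := by
      calc _ ≤ ν * c₀ * (M * n) ^ 2 := by gcongr
        _ = M ^ 2 * (ν * c₀ * n ^ 2) := by ring
        _ ≤ M ^ 2 * (D * ‖h‖) := by gcongr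
        _ = _ := by ring
    have e3 : ν * c₀ * ‖h‖ ^ 3 ≤ M ^ 2 * D := by
      refine le_of_mul_le_mul_right ?_ hx0
      calc _ = ν * c₀ * (‖h‖ ^ 2) ^ 2 := by ring
        _ ≤ _ := e2
    have e4 : ‖h‖ ^ 3 ≤ K := by
      rw [hK, le_div_iff₀ hc]; linarith
    have e5 : ‖h‖ ≤ ‖h‖ ^ 3 := le_self_pow₀ hx1 three_ne_zero
    linarith
  calc ‖u‖ = ‖u₀ + h‖ := by rw [hh, add_sub_cancel]
    _ ≤ ‖u₀‖ + ‖h‖ := norm_add_le _ _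
    _ ≤ _ := by linarith

/-- The stability estimate for an optimal control whose final state, and the one for the reference
parameter, differ from the desired state. -/
theorem normL1_sub_le {νmin νmax cs c₀ νbar : ℝ} (hstab : P.AdjointStability νmin νmax cs)
    (hP : ∀ ν ∈ Icc νmin νmax, Parabolic P.ι (P.operator ν) α ω)
    (hνmin : 0 < νmin) (hν : ν ∈ Icc νmin νmax) (hνbar : νbar ∈ Icc νmin νmax) (hc₀ : 0 < c₀)
    {u₀ u : Control ϱ} (hu₀ : u₀ ∈ P.Uad) (hgrowth : P.GrowthCondition νbar u₀ c₀)
    (hu : u ∈ P.optControls ν) (hy : P.finalState ν u ≠ P.yd) (hy' : P.finalState νbar u ≠ P.yd) :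
    normL1 ⇑(u - u₀) ≤ ENNReal.ofReal (max cs 0 / c₀ * |ν - νbar|) := by
  have hν0 : 0 < ν := hνmin.trans_le hν.1
  have hνb0 : 0 < νbar := hνmin.trans_le hνbar.1
  have hfin := hgrowth.normL1_ne_top (mul_pos hνb0 hc₀) hu.1
  have hg := hgrowth.2 u hu.1
  have h1 := fderiv_f_le (hP νbar hνbar) hgrowth.1 hy'
  have hn : 0 < ‖P.finalState ν u - P.yd‖ := norm_pos_iff.2 (sub_ne_zero.2 hy)
  -- Optimality of `u` for `ν`, tested with `u₀` and normalised so that `p₂` appears.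
  have h2 := mul_nonneg (inv_nonneg.2 hn.le) (inner_finalOp_nonneg (hP ν hν) hu hu₀)
  rw [← real_inner_smul_right, inner_finalOp (hP ν hν), ← neg_sub, map_neg, inner_neg_left] at h2
  have a1 := isAdjointState_backwardState (hP νbar hνbar) hy'
  have a2 := isAdjointState_backwardState (hP ν hν) hy
  set p₁ := P.backwardState νbar
    (‖P.finalState νbar u - P.yd‖⁻¹ • (P.finalState νbar u - P.yd))
  set p₂ := P.backwardState ν (‖P.finalState ν u - P.yd‖⁻¹ • (P.finalState ν u - P.yd))
  have h3 : ⟪P.controlOp (u - u₀), p₂⟫ ≤ 0 := by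
    have := nonneg_of_mul_nonneg_right h2 hν0
    linarith
  have h4 : ⟪P.controlOp (u - u₀), p₁ - p₂⟫ =
      ∫ t, ⟪P.Badj (p₁ t - p₂ t), (u - u₀ : Control ϱ) t⟫ ∂timeMeasure := by
    rw [inner_controlOp]
    refine integral_congr_ae ?_
    filter_upwards [Lp.coeFn_sub p₁ p₂] with t ht
    rw [ht, Pi.sub_apply]
  have h5 := hstab νbar hνbar ν hν u hu.1 p₁ p₂ a1 a2
  have h6 := ofReal_integral_inner_le (h := ⇑(u - u₀)) ENNReal.ofReal_ne_top h5
  rw [← h4] at h6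
  have h7 : fderiv ℝ (P.f νbar) u₀ (u - u₀) ≤ νbar * ⟪P.controlOp (u - u₀), p₁ - p₂⟫ := by
    refine h1.trans (mul_le_mul_of_nonneg_left ?_ hνb0.le)
    rw [inner_sub_right]
    linarith
  have h8 : ENNReal.ofReal (cs * |νbar - ν|) ≤ ENNReal.ofReal (max cs 0 * |νbar - ν|) :=
    ENNReal.ofReal_le_ofReal (by gcongr; exact le_max_left _ _)
  obtain ⟨n, hn0, hn⟩ : ∃ n : ℝ, 0 ≤ n ∧ normL1 ⇑(u - u₀) = ENNReal.ofReal n :=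
    ⟨_, ENNReal.toReal_nonneg, (ENNReal.ofReal_toReal hfin).symm⟩
  have hcs : 0 ≤ max cs 0 * |νbar - ν| := mul_nonneg (le_max_right _ _) (abs_nonneg _)
  have h9 := (hg.trans (ENNReal.ofReal_le_ofReal h7)).trans
    ((ENNReal.ofReal_mul hνb0.le).trans_le (mul_le_mul_right (h6.trans (mul_le_mul_left h8 _)) _))
  rw [hn, ← ENNReal.ofReal_mul hcs, ← ENNReal.ofReal_mul hνb0.le, ← ENNReal.ofReal_pow hn0,
    ← ENNReal.ofReal_mul (by positivity), ENNReal.ofReal_le_ofReal_iff (by positivity)] at h9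
  rw [hn]
  apply ENNReal.ofReal_le_ofReal
  rw [abs_sub_comm ν, div_mul_eq_mul_div, le_div_iff₀ hc₀]
  rcases hn0.eq_or_lt with rfl | hnpos
  · rwa [zero_mul]
  · have : νbar * n * (n * c₀) ≤ νbar * n * (max cs 0 * |νbar - ν|) := by linarith
    exact le_of_mul_le_mul_left this (by positivity)

end System

end ParabolicControl

end

/-! ### Conclusion: the degenerate case and the choice of `δ`. -/

theorem mainTheorem10 {V H Ω : Type*}
    [NormedAddCommGroup V] [InnerProductSpace ℝ V] [CompleteSpace V]
    [NormedAddCommGroup H] [InnerProductSpace ℝ H] [CompleteSpace H]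
    [MeasurableSpace Ω] {ϱ : Measure Ω} (P : ParabolicControl.System V H Ω ϱ)
    (νmin νmax cs : ℝ) (hνmin : 0 < νmin)
    (hstab : P.AdjointStability νmin νmax cs)
    (νbar : ℝ) (hνbar : νbar ∈ Ioo νmin νmax)
    (ubar : ParabolicControl.Control ϱ) (hubar : P.optControls νbar = {ubar})
    (c₀ : ℝ) (hc₀ : 0 < c₀) (hgrowth : P.GrowthCondition νbar ubar c₀) :
    ∃ δ > (0 : ℝ), ∃ c > (0 : ℝ), ∀ ν : ℝ, 0 < ν → |ν - νbar| ≤ δ → ∀ u ∈ P.optControls ν,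
      ParabolicControl.normL1 (u - ubar) ≤ ENNReal.ofReal (c * |ν - νbar|) := by
  have hopt : ubar ∈ P.optControls νbar := hubar ▸ mem_singleton ubar
  have hνb0 : 0 < νbar := hνmin.trans hνbar.1
  have hνb := Ioo_subset_Icc_self hνbar
  have hc : 0 < νbar * c₀ := mul_pos hνb0 hc₀
  by_cases hy : P.finalState νbar ubar = P.yd
  · have hmin : IsLocalMin (P.f νbar) ubar := Filter.Eventually.of_forall fun u => by
      simp [ParabolicControl.System.f, hy]
    refine ⟨1, one_pos, 1, one_pos, fun ν _ _ u hu => ?_⟩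
    have := hgrowth.2 u hu.1
    rw [hmin.fderiv_eq_zero, zero_apply, ENNReal.ofReal_zero, nonpos_iff_eq_zero,
      mul_eq_zero, or_iff_right (by simpa using hc), pow_eq_zero_iff two_ne_zero] at this
    rw [this]
    exact zero_le
  obtain ⟨α, ω, hP⟩ := P.exists_parabolic hνmin νmax (hνbar.1.trans hνbar.2).le
  obtain ⟨R, hR⟩ := hgrowth.exists_norm_le hc hopt.1
  obtain ⟨C, hC0, hC⟩ := P.exists_norm_finalState_sub_le hP R
  have hd0 : 0 < ‖P.finalState νbar ubar - P.yd‖ := norm_pos_iff.2 (sub_ne_zero.2 hy)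
  set d := ‖P.finalState νbar ubar - P.yd‖
  -- The inner minimum keeps `ν` in `[νmin, νmax]`; the bound `d / (C + 1)` makes the final state
  -- move by less than `d`, also when `C = 0`. In the constant `c`, the summand `1` ensures
  -- positivity when `cs ≤ 0`.
  refine ⟨min (min (νbar - νmin) (νmax - νbar)) (d / (C + 1)),
    lt_min (lt_min (sub_pos.2 hνbar.1) (sub_pos.2 hνbar.2)) (by positivity),
    max cs 0 / c₀ + 1, by positivity, fun ν _ hδ u hu => ?_⟩
  obtain ⟨h1, h2⟩ := le_min_iff.1 hδ
  obtain ⟨h3, h4⟩ := le_min_iff.1 h1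
  have hν : ν ∈ Icc νmin νmax := by
    constructor
    · linarith [neg_abs_le (ν - νbar)]
    · linarith [le_abs_self (ν - νbar)]
  have hdu := hopt.2 u hu.1
  have hy' : P.finalState νbar u ≠ P.yd := fun h => by
    rw [h, sub_self, norm_zero] at hdu
    exact hdu.not_gt hd0
  -- Hitting the target at `ν` would give `d ≤ C |ν - νbar|`, against the choice of `δ`.
  have hyν : P.finalState ν u ≠ P.yd := fun h => by
    have h5 := hC νbar hνb ν hν u (hR u hu.1)
    rw [h, abs_sub_comm] at h5
    rw [le_div_iff₀ (by positivity)] at h2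
    have h6 : |ν - νbar| = 0 := le_antisymm (by linarith) (abs_nonneg _)
    rw [h6, mul_zero] at h5
    linarith
  refine (ParabolicControl.System.normL1_sub_le hstab hP hνmin hν hνb hc₀ hopt.1 hgrowth hu hyν
    hy').trans (ENNReal.ofReal_le_ofReal ?_)
  gcongr
  linarith
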